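/- Consider, for $u:\mathbb R\times\mathbb R\to\mathbb C$, the focusing nonlocal derivative NLS equation $$ i u_t = u_{xx} - u\,(i+H)(|u|^2)_x, \qquad H(h)(x)=\frac1\pi\,\mathrm{p.v.}\!\int_{-\infty}^{\infty}\frac{h(y)\,dy}{y-x}, \tag{1}$$ where the principal value is a symmetric truncation at $y=x$ and at infinity. Let $k_1>0$, $\phi_1>0$, $x_1,x_2\in\mathbb R$, $c_1=-k_1$, let $\gamma_1\in\mathbb R$ satisfy $\gamma_1^2=k_1(e^{2\phi_1}-1)$, and write $\xi_j=x-c_jt-x_j$. Let either $c_2\in(0,\infty)$ or $c_2\in(-\infty,-2k_1)$ (two families), and put $$\beta_{12}=\frac{2k_1}{c_2(c_2+2k_1)},\qquad \chi_{12}=\frac{2(c_2+k_1)}{c_2(c_2+2k_1)},$$ $$\begin{aligned} f&=\beta_{12}(1-e^{ik_1\xi_1-\phi_1})-i\xi_2(1+e^{ik_1\xi_1-\phi_1}),&\quad g&=\gamma_1e^{ik_1\xi_1-\phi_1}(\chi_{12}-i\xi_2),\\ \tilde f&=\beta_{12}(1-e^{ik_1\xi_1+\phi_1})-i\xi_2(1+e^{ik_1\xi_1+\phi_1}),&\quad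 \tilde g&=\gamma_1(-\chi_{12}-i\xi_2).\end{aligned}$$ Then $\gamma_1^2>0$, $\beta_{12}>0$, and the following hold. (a) For every $t\in\mathbb R$, all zeros $x\in\mathbb C$ of $f$ satisfy $\mathrm{Im}\,x<0$ and all zeros of $\tilde f$ satisfy $\mathrm{Im}\,x>0$. (b) $u=g/f$ is a breather of speed $c_2$ on the traveling periodic wave $$v(x,t)=\frac{\gamma_1e^{ik_1\xi_1-\phi_1}}{1+e^{ik_1\xi_1-\phi_1}},$$ that is: $u$ and $v$ are smooth classical solutions of (1) on $\mathbb R\times\mathbb R$; $u(\cdot,t)\ne v(\cdot,t)$ for every $t$; $u(x,t)-v(x,t)\to0$ as $|x-c_2t|\to\infty$, uniformly in $t$; and $u$ is periodic in time in the frame moving with speed $c_2$, i.e. $u(x+c_2T,t+T)=u(x,t)$ for some $T>0$ and all $x,t\in\mathbb R$. (c) For all $x,t\in\mathbb R$, $\ \bar u=\tilde g/\tilde f$ and $|u|^2=i\,\partial_x\ln(f/\tilde f)$. (d) The breather is the long-wave limit of two-periodic waves. For real $k_2\neq0$ near $0$ let $A_{12}\in\mathbb R$, $\alpha_2$, $\gamma_{12}$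 be given by $$e^{-A_{12}}=\frac{(c_1-c_2)^2-(k_1+k_2)^2}{(c_1-c_2)^2-(k_1-k_2)^2},\qquad \alpha_2=\frac{c_2-k_2}{c_2+k_2},\qquad \gamma_{12}=\gamma_1\sqrt{\frac{c_2+k_2}{c_2-k_2}},$$ and let $F,\tilde F,G,\tilde G$ denote the functions $$\begin{aligned}F&=1+e^{ik_1\xi_1-\phi_1-\frac12A_{12}}+e^{ik_2\xi_2-\frac12A_{12}}+e^{ik_1\xi_1-\phi_1+ik_2\xi_2},\\ \tilde F&=1+e^{ik_1\xi_1+\phi_1-\frac12A_{12}}+e^{ik_2\xi_2-\frac12A_{12}}+e^{ik_1\xi_1+\phi_1+ik_2\xi_2},\\ G&=\gamma_{12}\big[e^{ik_1\xi_1-\phi_1-\frac12A_{12}}+\alpha_2e^{ik_1\xi_1-\phi_1+ik_2\xi_2}\big],\qquad \tilde G=\gamma_{12}\big[e^{ik_2\xi_2-\frac12A_{12}}+\alpha_2\big],\end{aligned}$$ in which $x_2$ is replaced by $x_2+\pi/k_2$. Then, as $k_2\to0$, $\ F/k_2\to f$, $\tilde F/k_2\to\tilde f$, $G/k_2\to g$,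 $\tilde G/k_2\to\tilde g$ at every $x\in\mathbb C$, $t\in\mathbb R$, and $G/F\to u$ at every $x,t\in\mathbb R$. -/

import Mathlib

open Filter Topology MeasureTheory
open scoped ContDiff ComplexConjugate

noncomputable section

namespace NonlocalDNLS

/-- `h` is the value at `x` of the Hilbert transform of `f`, in the convention
`H f (x) = π⁻¹ p.v. ∫ f(y) / (y - x) dy` on the real line. The principal value is taken both at the
singularity `y = x` and at infinity (a symmetric truncation at both places), so that bounded
functions which do not decay, such as trigonometric ones, are covered:
`H (e^{ikx}) = i sgn(k) e^{ikx}`. -/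
def HasHilbertTransformAt (f : ℝ → ℝ) (x h : ℝ) : Prop :=
  LocallyIntegrable f ∧
  Tendsto (fun p : ℝ × ℝ => Real.pi⁻¹ * ∫ y in {y : ℝ | p.1 < |y - x| ∧ |y - x| < p.2}, f y / (y - x))
    (𝓝[>] (0 : ℝ) ×ˢ atTop) (𝓝 h)

/-- Smooth classical solutions `u(x,t)`, on the whole plane, of the nonlocal derivative NLS equation
`i u_t = u_xx + σ u (i + H) (|u|²)_x`. The Hilbert transform is required to exist at every point. -/
structure IsSolution (σ : ℝ) (u : ℝ → ℝ → ℂ) : Prop where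
  smooth : ContDiff ℝ ∞ (fun p : ℝ × ℝ => u p.1 p.2)
  equation : ∀ x t : ℝ, ∃ h : ℝ,
    HasHilbertTransformAt (fun y => deriv (fun z => ‖u z t‖ ^ 2) y) x h ∧
    Complex.I * deriv (fun s => u x s) t =
      iteratedDeriv 2 (fun y => u y t) x +
        (σ : ℂ) * u x t * (Complex.I * ((deriv (fun z => ‖u z t‖ ^ 2) x : ℝ) : ℂ) + (h : ℂ))

/-- `u` is a breather of speed `c` on the background `v`: both are solutions, `u` differs from `v`
at all times, it approaches `v` as `|x - c t| → ∞`, uniformly in time, and it is periodic in time in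
the frame that moves with speed `c`. -/
structure IsBreatherOn (σ : ℝ) (v : ℝ → ℝ → ℂ) (c : ℝ) (u : ℝ → ℝ → ℂ) : Prop where
  background : IsSolution σ v
  solution : IsSolution σ u
  differs : ∀ t : ℝ, ∃ x : ℝ, u x t ≠ v x t
  asymptotic : Tendsto (fun p : ℝ × ℝ => u p.1 p.2 - v p.1 p.2)
    (comap (fun p : ℝ × ℝ => p.1 - c * p.2) (Bornology.cobounded ℝ)) (𝓝 0)
  recurrent : ∃ T : ℝ, 0 < T ∧ ∀ x t : ℝ, u (x + c * T) (t + T) = u x t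

/-- The phase `ξ = x - c t - x₀`, for complex `x`. -/
def xi (c x₀ : ℝ) (x : ℂ) (t : ℝ) : ℂ := x - c * t - x₀

/-- `e^{i k₁ ξ₁ + s}` with `ξ₁ = x - c₁ t - x₁` and `c₁ = -k₁`. -/
def wave (k₁ s x₁ : ℝ) (x : ℂ) (t : ℝ) : ℂ :=
  Complex.exp (Complex.I * k₁ * xi (-k₁) x₁ x t + s)

/-- The traveling periodic wave `u = γ₁ e^{i k₁ ξ₁ - φ₁} / (1 + e^{i k₁ ξ₁ - φ₁})`. -/
def periodicWave (k₁ φ₁ γ₁ x₁ : ℝ) (x t : ℝ) : ℂ :=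
  γ₁ * wave k₁ (-φ₁) x₁ x t / (1 + wave k₁ (-φ₁) x₁ x t)

/-- `β₁₂` -/
def beta (k₁ c₂ : ℝ) : ℝ := 2 * k₁ / (c₂ * (c₂ + 2 * k₁))

/-- `χ₁₂` -/
def chi (k₁ c₂ : ℝ) : ℝ := 2 * (c₂ + k₁) / (c₂ * (c₂ + 2 * k₁))

/-- The function `f` of the breather. -/
def breatherF (k₁ φ₁ c₂ x₁ x₂ : ℝ) (x : ℂ) (t : ℝ) : ℂ :=
  beta k₁ c₂ * (1 - wave k₁ (-φ₁) x₁ x t) -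
    Complex.I * xi c₂ x₂ x t * (1 + wave k₁ (-φ₁) x₁ x t)

/-- The function `f̃` of the breather. -/
def breatherFt (k₁ φ₁ c₂ x₁ x₂ : ℝ) (x : ℂ) (t : ℝ) : ℂ :=
  beta k₁ c₂ * (1 - wave k₁ φ₁ x₁ x t) -
    Complex.I * xi c₂ x₂ x t * (1 + wave k₁ φ₁ x₁ x t)

/-- The function `g` of the breather. -/
def breatherG (k₁ φ₁ γ₁ c₂ x₁ x₂ : ℝ) (x : ℂ) (t : ℝ) : ℂ :=
  γ₁ * wave k₁ (-φ₁) x₁ x t * (chi k₁ c₂ - Complex.I * xi c₂ x₂ x t)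

/-- The function `g̃` of the breather. -/
def breatherGt (k₁ γ₁ c₂ x₂ : ℝ) (x : ℂ) (t : ℝ) : ℂ :=
  γ₁ * (-chi k₁ c₂ - Complex.I * xi c₂ x₂ x t)

/-- `A₁₂`, given by `e^{-A₁₂} = ((c₁-c₂)² - (k₁+k₂)²) / ((c₁-c₂)² - (k₁-k₂)²)` with `c₁ = -k₁`. -/
def A12 (k₁ k₂ c₂ : ℝ) : ℝ :=
  -Real.log (((-k₁ - c₂) ^ 2 - (k₁ + k₂) ^ 2) / ((-k₁ - c₂) ^ 2 - (k₁ - k₂) ^ 2))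

/-- `α₂` -/
def alpha2 (k₂ c₂ : ℝ) : ℝ := (c₂ - k₂) / (c₂ + k₂)

/-- `γ₁₂`: for `γ₁² = k₁ (e^{2φ₁} - 1)` it is the root, with the sign of `γ₁`, of
`γ₁₂² = k₁ (e^{2φ₁} - 1) (c₂ + k₂) / (c₂ - k₂)`. -/
def gamma12 (γ₁ k₂ c₂ : ℝ) : ℝ := γ₁ * √((c₂ + k₂) / (c₂ - k₂))

/-- The function `f` of the `2`-periodic wave. -/
def twoPeriodicF (k₁ φ₁ k₂ c₂ x₁ x₂ : ℝ) (x : ℂ) (t : ℝ) : ℂ :=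
  1 + wave k₁ (-φ₁ - A12 k₁ k₂ c₂ / 2) x₁ x t
    + Complex.exp (Complex.I * k₂ * xi c₂ x₂ x t - A12 k₁ k₂ c₂ / 2)
    + wave k₁ (-φ₁) x₁ x t * Complex.exp (Complex.I * k₂ * xi c₂ x₂ x t)

/-- The function `f̃` of the `2`-periodic wave. -/
def twoPeriodicFt (k₁ φ₁ k₂ c₂ x₁ x₂ : ℝ) (x : ℂ) (t : ℝ) : ℂ :=
  1 + wave k₁ (φ₁ - A12 k₁ k₂ c₂ / 2) x₁ x t
    + Complex.exp (Complex.I * k₂ * xi c₂ x₂ x t - A12 k₁ k₂ c₂ / 2)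
    + wave k₁ φ₁ x₁ x t * Complex.exp (Complex.I * k₂ * xi c₂ x₂ x t)

/-- The function `g` of the `2`-periodic wave. -/
def twoPeriodicG (k₁ φ₁ γ₁ k₂ c₂ x₁ x₂ : ℝ) (x : ℂ) (t : ℝ) : ℂ :=
  gamma12 γ₁ k₂ c₂ * (wave k₁ (-φ₁ - A12 k₁ k₂ c₂ / 2) x₁ x t
    + alpha2 k₂ c₂ * (wave k₁ (-φ₁) x₁ x t * Complex.exp (Complex.I * k₂ * xi c₂ x₂ x t)))

/-- The function `g̃` of the `2`-periodic wave. -/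
def twoPeriodicGt (k₁ γ₁ k₂ c₂ x₂ : ℝ) (x : ℂ) (t : ℝ) : ℂ :=
  gamma12 γ₁ k₂ c₂ * (Complex.exp (Complex.I * k₂ * xi c₂ x₂ x t - A12 k₁ k₂ c₂ / 2)
    + alpha2 k₂ c₂)

end NonlocalDNLS

end

/-! The nonlocal term becomes local through holomorphy. If `P` is holomorphic and bounded on the
upper half plane, continuous up to the real axis, and tends to 0 as `Im z → ∞`, then closing the
contour of `P(z)/(z - x)` with half circles gives `H(Im P) = Re P` (`hasHilbertTransformAt_im`), so
`(i + H)(Im P) = P`. Apply this to `P = (log f)''`, where `f` has no zeros in the closed upper half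
plane. If `|g/f|² = k - 2 Im (f'/f)` on the real line, then `(i + H)(|u|²)_x = -2 (log f)''`, and
(1) for `u = g/f` becomes the bilinear equation `i (g_t f - g f_t) = g_xx f - 2 g_x f_x + g f_xx`
(`isSolution_of_bilinear`). The periodic wave is the case `f = 1 + w`, `g = γ w`, where `w` is the
exponential. For the breather, write `f = (1 + w) L` with `L = β (1 - w)/(1 + w) - i ξ₂`. When `Im x
≥ 0`, `|w| ≤ e^{-φ} < 1`, so the Cayley transform and `-i ξ₂` contribute respectively positive and
nonnegative real part to `L`. Hence `f ≠ 0`, and `1/L` is bounded and decays; this controls `(log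
f)''` and also `u - v`, which is a bounded factor times `1/L`. The bilinear and modulus identities
are polynomial consequences of `c (β + χ) = 2` and `(c + 2k)(χ - β) = 2`, together with the
amplitude relation for `γ` in the modulus identity. Reflection in the real axis sends `f`, `g` to
`f̃`, `g̃` up to a common factor, which yields the zeros of `f̃` and the formula for `ū`. The shift
by `π/k₂` makes the two-periodic functions vanish at `k₂ = 0`, so the long-wave limits are
derivatives there. -/

namespace NonlocalDNLS

/-! ### Hilbert transform of boundary values of holomorphic functions. -/

/-- Cauchy's theorem on the upper half annulus centred at a real point, written in the
coordinate `w` with `z = x + e^w`. -/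
theorem integral_log_scale_eq {P : ℂ → ℂ} (hc : ContinuousOn P {z | 0 ≤ z.im})
    (hd : DifferentiableOn ℂ P {z | 0 < z.im}) (x a b : ℝ) :
    (∫ s in a..b, (P ((x + Real.exp s : ℝ)) - P ((x - Real.exp s : ℝ)))) =
      Complex.I * (∫ θ in (0 : ℝ)..Real.pi, P (x + Real.exp a * Complex.exp (θ * Complex.I))) -
      Complex.I * (∫ θ in (0 : ℝ)..Real.pi, P (x + Real.exp b * Complex.exp (θ * Complex.I))) := by
  have him : ∀ w : ℂ, ((x : ℂ) + Complex.exp w).im = Real.exp w.re * Real.sin w.im := by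
    intro w; simp [Complex.exp_im]
  have hci : ContinuousOn (fun w : ℂ => P (x + Complex.exp w))
      (Set.uIcc a b ×ℂ Set.uIcc 0 Real.pi) := by
    refine hc.comp (by fun_prop) ?_
    rintro w ⟨-, hw⟩
    rw [Set.mem_preimage, Set.uIcc_of_le Real.pi_pos.le] at hw
    change 0 ≤ (_ : ℂ).im
    rw [him]
    exact mul_nonneg (Real.exp_pos _).le (Real.sin_nonneg_of_mem_Icc hw)
  have hdi : DifferentiableOn ℂ (fun w : ℂ => P (x + Complex.exp w))
      (Set.Ioo (min a b) (max a b) ×ℂ Set.Ioo (min 0 Real.pi) (max 0 Real.pi)) := by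
    refine hd.comp (by fun_prop) ?_
    rintro w ⟨-, hw⟩
    rw [Set.mem_preimage, min_eq_left Real.pi_pos.le, max_eq_right Real.pi_pos.le] at hw
    change 0 < (_ : ℂ).im
    rw [him]
    exact mul_pos (Real.exp_pos _) (Real.sin_pos_of_mem_Ioo hw)
  have key := Complex.integral_boundary_rect_eq_zero_of_continuousOn_of_differentiableOn
    (fun w : ℂ => P (x + Complex.exp w)) (a : ℂ) (b + Real.pi * Complex.I)
    (by simpa using hci) (by simpa using hdi)
  simp only [Complex.ofReal_re, Complex.ofReal_im, Complex.add_re, Complex.mul_re, Complex.I_re,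
    Complex.I_im, Complex.add_im, Complex.mul_im, mul_zero, mul_one, zero_mul, sub_zero, add_zero,
    zero_add, Complex.ofReal_zero, Complex.exp_add, Complex.exp_pi_mul_I, smul_eq_mul,
    ← Complex.ofReal_exp] at key
  have hp : ∀ σ : ℝ, Continuous fun s : ℝ => P ((x + σ * Real.exp s : ℝ)) := fun σ =>
    hc.comp_continuous (by fun_prop) fun s => by
      change 0 ≤ (_ : ℂ).im
      rw [Complex.ofReal_im]
  rw [intervalIntegral.integral_sub
    (by simpa using (hp 1).intervalIntegrable a b)
    (by simpa [← sub_eq_add_neg] using (hp (-1)).intervalIntegrable a b)]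
  push_cast at key ⊢
  simp only [mul_neg, mul_one, ← sub_eq_add_neg] at key
  linear_combination key

theorem setOf_annulus (x ε R : ℝ) (hε : 0 < ε) :
    {y : ℝ | ε < |y - x| ∧ |y - x| < R} =
      (fun y => x + y) '' Set.Ioo ε R ∪ (fun y => x - y) '' Set.Ioo ε R := by
  ext y
  simp only [Set.mem_ofPred_eq, Set.image_const_add_Ioo, Set.image_const_sub_Ioo, Set.mem_union,
    Set.mem_Ioo]
  rcases le_or_gt 0 (y - x) with h | h
  · rw [abs_of_nonneg h]
    constructor
    · rintro ⟨h1, h2⟩; left; constructor <;> linarith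
    · rintro (⟨h1, h2⟩ | ⟨h1, h2⟩) <;> constructor <;> linarith
  · rw [abs_of_neg h]
    constructor
    · rintro ⟨h1, h2⟩; right; constructor <;> linarith
    · rintro (⟨h1, h2⟩ | ⟨h1, h2⟩) <;> constructor <;> linarith

/-- The integral of `p(y)/(y-x)` over a symmetric annulus around `x`, in logarithmic scale. -/
theorem integral_annulus_eq {p : ℝ → ℝ} (hp : Continuous p) (x ε R : ℝ) (hε : 0 < ε) (hR : ε ≤ R) :
    (∫ y in {y : ℝ | ε < |y - x| ∧ |y - x| < R}, p y / (y - x)) =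
      ∫ s in (Real.log ε)..(Real.log R), (p (x + Real.exp s) - p (x - Real.exp s)) := by
  have hR0 : 0 < R := hε.trans_le hR
  have hci : ∀ c d : ℝ, (0 < c ∨ d < 0) → c ≤ d →
      IntegrableOn (fun y => p (x + y) / y) (Set.Icc c d) := by
    intro c d h _
    refine ContinuousOn.integrableOn_Icc ?_
    refine ContinuousOn.div (by fun_prop) (by fun_prop) fun y hy h0 => ?_
    subst h0
    rcases h with h | h
    · exact absurd hy.1 (not_le.2 h)
    · exact absurd hy.2 (not_le.2 h)
  have hset : {y : ℝ | ε < |y - x| ∧ |y - x| < R} =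
      (fun y => x + y) '' (Set.Ioo ε R ∪ Set.Ioo (-R) (-ε)) := by
    rw [setOf_annulus x ε R hε, Set.image_union]
    simp only [Set.image_const_sub_Ioo, Set.image_const_add_Ioo, ← sub_eq_add_neg]
  rw [hset, (measurePreserving_add_left volume x).setIntegral_image_emb
    (measurableEmbedding_addLeft x)]
  simp only [add_sub_cancel_left]
  rw [setIntegral_union _ measurableSet_Ioo
    ((hci ε R (Or.inl hε) hR).mono_set Set.Ioo_subset_Icc_self)
    ((hci (-R) (-ε) (Or.inr (by linarith)) (by linarith)).mono_set Set.Ioo_subset_Icc_self)]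
  · rw [← integral_Ioc_eq_integral_Ioo, ← integral_Ioc_eq_integral_Ioo,
      ← intervalIntegral.integral_of_le hR, ← intervalIntegral.integral_of_le (by linarith)]
    have h2 : (∫ y in (-R)..(-ε), p (x + y) / y) = ∫ y in ε..R, - (p (x - y) / y) := by
      rw [← intervalIntegral.integral_comp_neg]
      simp [sub_eq_add_neg, div_neg]
    have hn : ∀ y ∈ Set.uIcc ε R, y ≠ 0 := fun y hy => by
      rw [Set.uIcc_of_le hR] at hy
      exact (hε.trans_le hy.1).ne'
    rw [h2, ← intervalIntegral.integral_add
      (f := fun y => p (x + y) / y) (g := fun y => -(p (x - y) / y))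
      (ContinuousOn.intervalIntegrable (ContinuousOn.div (by fun_prop) (by fun_prop) hn))
      (ContinuousOn.intervalIntegrable (ContinuousOn.div (by fun_prop) (by fun_prop) hn).neg)]
    -- Substituting `y = e^s` absorbs the kernel: `dy / y = ds`.
    have := intervalIntegral.integral_comp_mul_deriv'''
      (f := Real.exp) (f' := Real.exp) (a := Real.log ε) (b := Real.log R)
      (g := fun y => p (x + y) / y + - (p (x - y) / y)) (by fun_prop)
      (fun s _ => (Real.hasDerivAt_exp s).hasDerivWithinAt) ?_ ?_ ?_
    · rw [Real.exp_log hε, Real.exp_log hR0] at this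
      rw [← this]
      refine intervalIntegral.integral_congr fun s _ => ?_
      have := Real.exp_ne_zero s
      simp only [Function.comp]
      field_simp
      ring
    · refine ContinuousOn.mono (s := {0}ᶜ) ?_ ?_
      · refine ContinuousOn.add (ContinuousOn.div (by fun_prop) (by fun_prop) fun _ h => h)
          (ContinuousOn.div (by fun_prop) (by fun_prop) fun _ h => h).neg
      · rintro _ ⟨s, -, rfl⟩; exact Real.exp_ne_zero s
    · refine ContinuousOn.integrableOn_compact (isCompact_uIcc.image Real.continuous_exp) ?_
      refine ContinuousOn.mono (s := {0}ᶜ) ?_ ?_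
      · refine ContinuousOn.add (ContinuousOn.div (by fun_prop) (by fun_prop) fun _ h => h)
          (ContinuousOn.div (by fun_prop) (by fun_prop) fun _ h => h).neg
      · rintro _ ⟨s, -, rfl⟩; exact Real.exp_ne_zero s
    · refine Continuous.integrableOn_uIcc ?_
      have : Continuous fun s => p (x + Real.exp s) / Real.exp s + - (p (x - Real.exp s) / Real.exp s) :=
        (Continuous.div (by fun_prop) (by fun_prop) Real.exp_ne_zero).add
          (Continuous.div (by fun_prop) (by fun_prop) Real.exp_ne_zero).neg
      exact this.mul Real.continuous_exp
  · rw [Set.disjoint_left]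
    rintro y ⟨h1, -⟩ ⟨-, h2⟩
    linarith

/-- A bounded holomorphic function on the upper half plane which vanishes at `+i∞` is an
eigenfunction of the Hilbert transform; here is the resulting statement for its imaginary part. -/
theorem hasHilbertTransformAt_im {P : ℂ → ℂ} (hc : ContinuousOn P {z | 0 ≤ z.im})
    (hd : DifferentiableOn ℂ P {z | 0 < z.im}) {C : ℝ} (hC : ∀ z : ℂ, 0 ≤ z.im → ‖P z‖ ≤ C)
    (h0 : Tendsto P (comap Complex.im atTop) (𝓝 0)) (x : ℝ) :
    HasHilbertTransformAt (fun y : ℝ => (P y).im) x (P x).re := by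
  have hPc : Continuous fun y : ℝ => P y :=
    hc.comp_continuous (by fun_prop) fun s => by
      change 0 ≤ (_ : ℂ).im
      rw [Complex.ofReal_im]
  have hpc : Continuous fun y : ℝ => (P y).im := Complex.continuous_im.comp hPc
  have harc : ∀ r : ℝ, 0 ≤ r → ∀ θ ∈ Set.uIcc (0 : ℝ) Real.pi,
      0 ≤ ((x : ℂ) + r * Complex.exp (θ * Complex.I)).im := by
    intro r hr θ hθ
    rw [Set.uIcc_of_le Real.pi_pos.le] at hθ
    simpa [Complex.exp_ofReal_mul_I_im] using mul_nonneg hr (Real.sin_nonneg_of_mem_Icc hθ)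
  have hmeas : ∀ r : ℝ, 0 ≤ r → AEStronglyMeasurable
      (fun θ : ℝ => P (x + r * Complex.exp (θ * Complex.I)))
      (volume.restrict (Set.uIoc 0 Real.pi)) := by
    intro r hr
    refine ContinuousOn.aestronglyMeasurable ?_ measurableSet_uIoc
    exact hc.comp (by fun_prop) fun θ hθ => harc r hr θ (Set.uIoc_subset_uIcc hθ)
  refine ⟨hpc.locallyIntegrable, ?_⟩
  -- The small half circle produces the residue term, half of the full `2π`.
  have hsmall : Tendsto (fun r : ℝ => ∫ θ in (0 : ℝ)..Real.pi,
      P (x + r * Complex.exp (θ * Complex.I))) (𝓝[>] 0) (𝓝 (Real.pi * P x)) := by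
    have : (Real.pi * P x : ℂ) = ∫ _ in (0 : ℝ)..Real.pi, P x := by simp
    rw [this]
    refine intervalIntegral.tendsto_integral_filter_of_dominated_convergence (fun _ => C) ?_ ?_
      (by simp) ?_
    · filter_upwards [self_mem_nhdsWithin] with r hr using hmeas r (le_of_lt hr)
    · filter_upwards [self_mem_nhdsWithin] with r hr
      exact Eventually.of_forall fun θ hθ =>
        hC _ (harc r (le_of_lt hr) θ (Set.uIoc_subset_uIcc hθ))
    · refine Eventually.of_forall fun θ hθ => ?_
      have hx : ContinuousWithinAt P {z | 0 ≤ z.im} (x : ℂ) := hc _ (by simp)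
      refine hx.tendsto.comp (tendsto_nhdsWithin_iff.2 ⟨?_, ?_⟩)
      · have : Continuous fun r : ℝ => (x : ℂ) + r * Complex.exp (θ * Complex.I) := by fun_prop
        simpa using (this.tendsto 0).mono_left nhdsWithin_le_nhds
      · filter_upwards [self_mem_nhdsWithin] with r hr
        exact harc r (le_of_lt hr) θ (Set.uIoc_subset_uIcc hθ)
  have hlarge : Tendsto (fun r : ℝ => ∫ θ in (0 : ℝ)..Real.pi,
      P (x + r * Complex.exp (θ * Complex.I))) atTop (𝓝 0) := by
    have : (0 : ℂ) = ∫ _ in (0 : ℝ)..Real.pi, (0 : ℂ) := by simp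
    rw [this]
    refine intervalIntegral.tendsto_integral_filter_of_dominated_convergence (fun _ => C) ?_ ?_
      (by simp) ?_
    · filter_upwards [eventually_ge_atTop 0] with r hr using hmeas r hr
    · filter_upwards [eventually_ge_atTop 0] with r hr
      exact Eventually.of_forall fun θ hθ => hC _ (harc r hr θ (Set.uIoc_subset_uIcc hθ))
    -- At `θ = π` the point stays on the real axis, where no decay of `P` is assumed; one angle is
    -- negligible, and `θ = 0` is already outside the half-open interval.
    · have hne : ∀ᵐ θ : ℝ, θ ≠ Real.pi := by simp [ae_iff]
      filter_upwards [hne] with θ hθπ hθ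
      rw [Set.uIoc_of_le Real.pi_pos.le] at hθ
      refine h0.comp (tendsto_comap_iff.2 ?_)
      have hs : 0 < Real.sin θ := Real.sin_pos_of_mem_Ioo ⟨hθ.1, lt_of_le_of_ne hθ.2 hθπ⟩
      simpa [Function.comp_def, Complex.exp_ofReal_mul_I_im] using tendsto_id.atTop_mul_const hs
  have hlim : Tendsto (fun p : ℝ × ℝ => Real.pi⁻¹ * (Complex.I *
      (∫ θ in (0 : ℝ)..Real.pi, P (x + p.1 * Complex.exp (θ * Complex.I))) -
      Complex.I * (∫ θ in (0 : ℝ)..Real.pi, P (x + p.2 * Complex.exp (θ * Complex.I)))).im)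
      (𝓝[>] (0 : ℝ) ×ˢ atTop) (𝓝 (P x).re) := by
    have h1 := (((hsmall.comp tendsto_fst).const_mul Complex.I).sub
      ((hlarge.comp (tendsto_snd (f := 𝓝[>] (0 : ℝ)))).const_mul Complex.I))
    have h2 := ((Complex.continuous_im.tendsto _).comp h1).const_mul Real.pi⁻¹
    have h3 : Real.pi⁻¹ * (Complex.I * (Real.pi * P x) - Complex.I * 0).im = (P x).re := by
      simp [Real.pi_ne_zero]
    rw [h3] at h2
    exact h2
  refine hlim.congr' ?_
  have hev : ∀ᶠ p : ℝ × ℝ in 𝓝[>] (0 : ℝ) ×ˢ atTop, (0 < p.1 ∧ p.1 < 1) ∧ 1 ≤ p.2 :=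
    (((eventually_mem_nhdsWithin).and
      (nhdsWithin_le_nhds (eventually_lt_nhds one_pos))).prod_mk (eventually_ge_atTop 1))
  filter_upwards [hev] with p hp
  obtain ⟨⟨hp0, hp1⟩, hp2⟩ := hp
  rw [integral_annulus_eq hpc x p.1 p.2 hp0 (hp1.le.trans hp2)]
  have key := integral_log_scale_eq hc hd x (Real.log p.1) (Real.log p.2)
  rw [Real.exp_log hp0, Real.exp_log (one_pos.trans_le hp2)] at key
  rw [← key]
  congr 1
  have hi : IntervalIntegrable (fun s : ℝ => P ((x + Real.exp s : ℝ)) - P ((x - Real.exp s : ℝ)))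
      volume (Real.log p.1) (Real.log p.2) :=
    ((hPc.comp (by fun_prop : Continuous fun s => x + Real.exp s)).sub
      (hPc.comp (by fun_prop : Continuous fun s => x - Real.exp s))).intervalIntegrable _ _
  have := Complex.imCLM.intervalIntegral_comp_comm hi
  simpa using this.symm

theorem HasHilbertTransformAt.const_mul {f : ℝ → ℝ} {x h : ℝ} (hf : HasHilbertTransformAt f x h)
    (a : ℝ) : HasHilbertTransformAt (fun y => a * f y) x (a * h) := by
  refine ⟨hf.1.smul a, ?_⟩
  have := hf.2.const_mul a
  simp only [mul_div_assoc, integral_const_mul]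
  simpa only [mul_left_comm] using this

/-! ### Reduction of the nonlocal equation to a bilinear one. -/

/-- `(log f)''` in terms of `f`, `f'`, `f''`. -/
noncomputable def logSecondDeriv (f f₁ f₂ : ℂ) : ℂ := (f₂ * f - f₁ ^ 2) / f ^ 2

/-- The nonlocal equation is reduced to a bilinear one when `|g/f|²` is, up to a constant,
`-2 Im (log f)'` with `f` zero free on the closed upper half plane. -/
theorem isSolution_of_bilinear (k : ℝ) {f f₁ f₂ g g₁ g₂ fₜ gₜ : ℂ → ℝ → ℂ}
    (hf : ∀ x t, HasDerivAt (fun z => f z t) (f₁ x t) x)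
    (hf₁ : ∀ x t, HasDerivAt (fun z => f₁ z t) (f₂ x t) x)
    (hf₂ : ∀ t, Differentiable ℂ (fun z => f₂ z t))
    (hg : ∀ x t, HasDerivAt (fun z => g z t) (g₁ x t) x)
    (hg₁ : ∀ x t, HasDerivAt (fun z => g₁ z t) (g₂ x t) x)
    (hft : ∀ x t, HasDerivAt (fun s => f x s) (fₜ x t) t)
    (hgt : ∀ x t, HasDerivAt (fun s => g x s) (gₜ x t) t)
    (hfs : ContDiff ℝ ∞ (fun p : ℝ × ℝ => f p.1 p.2))
    (hgs : ContDiff ℝ ∞ (fun p : ℝ × ℝ => g p.1 p.2))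
    (hne : ∀ (x : ℂ) t, 0 ≤ x.im → f x t ≠ 0)
    (hnorm : ∀ x t : ℝ, ‖g x t / f x t‖ ^ 2 = k - 2 * (f₁ x t / f x t).im)
    (hbil : ∀ x t, Complex.I * (gₜ x t * f x t - g x t * fₜ x t) =
      g₂ x t * f x t - 2 * g₁ x t * f₁ x t + g x t * f₂ x t)
    (hbdd : ∀ t, ∃ C, ∀ z : ℂ, 0 ≤ z.im → ‖logSecondDeriv (f z t) (f₁ z t) (f₂ z t)‖ ≤ C)
    (hlim : ∀ t, Tendsto (fun z => logSecondDeriv (f z t) (f₁ z t) (f₂ z t))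
      (comap Complex.im atTop) (𝓝 0)) :
    IsSolution (-1) (fun x t : ℝ => g x t / f x t) := by
  have hr : ∀ x t : ℝ, f x t ≠ 0 := fun x t => hne x t (by simp)
  have hfr : ∀ x t : ℝ, HasDerivAt (fun z : ℝ => f z t) (f₁ x t) x :=
    fun x t => (hf x t).comp_ofReal
  have hf₁r : ∀ x t : ℝ, HasDerivAt (fun z : ℝ => f₁ z t) (f₂ x t) x :=
    fun x t => (hf₁ x t).comp_ofReal
  have hgr : ∀ x t : ℝ, HasDerivAt (fun z : ℝ => g z t) (g₁ x t) x :=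
    fun x t => (hg x t).comp_ofReal
  have hg₁r : ∀ x t : ℝ, HasDerivAt (fun z : ℝ => g₁ z t) (g₂ x t) x :=
    fun x t => (hg₁ x t).comp_ofReal
  refine ⟨?_, fun x t => ?_⟩
  · simp only [div_eq_mul_inv]
    exact hgs.mul (hfs.inv fun p => hr p.1 p.2)
  set P : ℂ → ℂ := fun z => logSecondDeriv (f z t) (f₁ z t) (f₂ z t) with hP
  have hPd : ∀ z : ℂ, 0 ≤ z.im → DifferentiableAt ℂ P z := fun z hz =>
    ((((hf₂ t) z).mul (hf z t).differentiableAt).sub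
      ((hf₁ z t).differentiableAt.pow 2)).div ((hf z t).differentiableAt.pow 2)
      (pow_ne_zero 2 (hne z t hz))
  obtain ⟨C, hC⟩ := hbdd t
  have hH := (hasHilbertTransformAt_im (P := P)
    (fun z hz => (hPd z hz).continuousAt.continuousWithinAt)
    (fun z hz => (hPd z (le_of_lt hz)).differentiableWithinAt) hC (hlim t) x).const_mul (-2)
  have hdn : ∀ y : ℝ, deriv (fun z : ℝ => ‖g z t / f z t‖ ^ 2) y = -2 * (P y).im := by
    intro y
    have h1 : HasDerivAt (fun z : ℝ => f₁ z t / f z t) (P y) y := by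
      refine ((hf₁r y t).fun_div (hfr y t) (hr y t)).congr_deriv ?_
      simp only [hP, logSecondDeriv]
      ring
    have h2 := (Complex.imCLM.hasFDerivAt.comp_hasDerivAt y h1).const_mul 2
    have h3 := h2.const_sub k
    have h4 : (fun z : ℝ => ‖g z t / f z t‖ ^ 2) =
        fun z : ℝ => k - 2 * (f₁ z t / f z t).im := funext fun z => hnorm z t
    rw [h4]
    exact (h3.congr_deriv (by simp)).deriv
  have hdn' : (fun y => deriv (fun z : ℝ => ‖g z t / f z t‖ ^ 2) y) =
      fun y : ℝ => -2 * (P y).im := funext hdn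
  refine ⟨-2 * (P x).re, ?_, ?_⟩
  · rw [hdn']
    exact hH
  have hu : ∀ y : ℝ, HasDerivAt (fun z : ℝ => g z t / f z t)
      ((g₁ y t * f y t - g y t * f₁ y t) / f y t ^ 2) y := fun y =>
    (hgr y t).div (hfr y t) (hr y t)
  have hut : deriv (fun s : ℝ => g x s / f x s) t =
      (gₜ x t * f x t - g x t * fₜ x t) / f x t ^ 2 :=
    ((hgt x t).div (hft x t) (hr x t)).deriv
  have huxx : iteratedDeriv 2 (fun y : ℝ => g y t / f y t) x =
      ((g₂ x t * f x t - g x t * f₂ x t) * f x t ^ 2 -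
        (g₁ x t * f x t - g x t * f₁ x t) * (2 * f x t * f₁ x t)) / (f x t ^ 2) ^ 2 := by
    rw [iteratedDeriv_succ, iteratedDeriv_one, funext fun y => (hu y).deriv]
    refine (HasDerivAt.congr_deriv
      ((((hg₁r x t).fun_mul (hfr x t)).fun_sub ((hgr x t).fun_mul (hf₁r x t))).fun_div
        ((hfr x t).fun_pow 2) (pow_ne_zero 2 (hr x t))) ?_).deriv
    push_cast
    ring
  -- The operator `i + H` reassembles the holomorphic function from its imaginary part, so the
  -- nonlocal term is now the local expression `-2 (log f)''`.
  have hPx : Complex.I * ((-2 * (P x).im : ℝ) : ℂ) + ((-2 * (P x).re : ℝ) : ℂ) = -2 * P x := by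
    conv_rhs => rw [← Complex.re_add_im (P x)]
    push_cast
    ring
  change Complex.I * deriv (fun s : ℝ => g x s / f x s) t =
    iteratedDeriv 2 (fun y : ℝ => g y t / f y t) x + ((-1 : ℝ) : ℂ) * (g x t / f x t) *
      (Complex.I * ((deriv (fun z : ℝ => ‖g z t / f z t‖ ^ 2) x : ℝ) : ℂ) + _)
  rw [hdn, hPx, hut, huxx, mul_div_assoc', hbil]
  simp only [hP, logSecondDeriv]
  have := hr x t
  push_cast
  field_simp
  ring

/-- On real arguments `|g/f|² = k - 2 Im (f'/f)` amounts to an identity between `f`, `f'`, `g`. -/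
theorem norm_div_sq_eq {k : ℝ} {f f₁ g : ℂ} (hf : f ≠ 0)
    (h : g * conj g = k * (f * conj f) + Complex.I * (f₁ * conj f - conj f₁ * f)) :
    ‖g / f‖ ^ 2 = k - 2 * (f₁ / f).im := by
  have hc : conj f ≠ 0 := by simpa using hf
  have h2 : ((-2 * (f₁ / f).im : ℝ) : ℂ) = Complex.I * (f₁ / f - conj (f₁ / f)) := by
    rw [Complex.sub_conj]
    push_cast
    linear_combination (-2 * ((f₁ / f).im : ℂ)) * Complex.I_mul_I
  have h1 : ((‖g / f‖ ^ 2 : ℝ) : ℂ) = ((k - 2 * (f₁ / f).im : ℝ) : ℂ) := by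
    rw [sub_eq_add_neg, ← neg_mul, Complex.ofReal_add, h2, Complex.ofReal_pow, ← Complex.mul_conj']
    simp only [map_div₀]
    field_simp
    linear_combination h
  exact_mod_cast h1

/-! ### Calculus and bounds for the phase and the exponential. -/

theorem hasDerivAt_xi (c x₀ : ℝ) (x : ℂ) (t : ℝ) :
    HasDerivAt (fun z => xi c x₀ z t) 1 x := by
  simpa [xi] using ((hasDerivAt_id x).sub_const ((c : ℂ) * t)).sub_const (x₀ : ℂ)

theorem hasDerivAt_xi_time (c x₀ : ℝ) (x : ℂ) (t : ℝ) :
    HasDerivAt (fun s => xi c x₀ x s) (-c) t := by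
  simpa [xi] using
    ((((hasDerivAt_id t).ofReal_comp).const_mul (c : ℂ)).const_sub x).sub_const (x₀ : ℂ)

theorem hasDerivAt_wave (k s x₁ : ℝ) (x : ℂ) (t : ℝ) :
    HasDerivAt (fun z => wave k s x₁ z t) (Complex.I * k * wave k s x₁ x t) x := by
  unfold wave
  exact ((((hasDerivAt_xi (-k) x₁ x t).const_mul (Complex.I * k)).add_const (s : ℂ)).cexp).congr_deriv
    (by ring)

theorem hasDerivAt_wave_time (k s x₁ : ℝ) (x : ℂ) (t : ℝ) :
    HasDerivAt (fun z => wave k s x₁ x z) (Complex.I * k ^ 2 * wave k s x₁ x t) t := by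
  unfold wave
  exact ((((hasDerivAt_xi_time (-k) x₁ x t).const_mul (Complex.I * k)).add_const
    (s : ℂ)).cexp).congr_deriv (by push_cast; ring)

theorem contDiff_xi (c x₀ : ℝ) : ContDiff ℝ ∞ (fun p : ℝ × ℝ => xi c x₀ p.1 p.2) := by
  have h1 : ContDiff ℝ ∞ (fun p : ℝ × ℝ => (p.1 : ℂ)) := Complex.ofRealCLM.contDiff.comp contDiff_fst
  have h2 : ContDiff ℝ ∞ (fun p : ℝ × ℝ => (p.2 : ℂ)) := Complex.ofRealCLM.contDiff.comp contDiff_snd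
  unfold xi
  exact (h1.sub (contDiff_const.mul h2)).sub contDiff_const

theorem contDiff_wave (k s x₁ : ℝ) : ContDiff ℝ ∞ (fun p : ℝ × ℝ => wave k s x₁ p.1 p.2) := by
  unfold wave
  exact ((contDiff_const.mul (contDiff_xi (-k) x₁)).add contDiff_const).cexp

theorem norm_wave (k s x₁ : ℝ) (x : ℂ) (t : ℝ) :
    ‖wave k s x₁ x t‖ = Real.exp (-k * x.im + s) := by
  simp [wave, xi, Complex.norm_exp]

theorem wave_add (k s s' x₁ : ℝ) (x : ℂ) (t : ℝ) :
    wave k (s + s') x₁ x t = Real.exp s' * wave k s x₁ x t := by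
  simp only [wave, Complex.ofReal_exp, ← Complex.exp_add]
  congr 1
  push_cast
  ring

/-- Schwarz reflection inverts the exponential and flips the sign of the shift; this is what
exchanges `f` with `f̃`. -/
theorem conj_wave_mul (k s x₁ : ℝ) (x : ℂ) (t : ℝ) :
    conj (wave k (-s) x₁ (conj x) t) * wave k s x₁ x t = 1 := by
  simp only [wave, ← Complex.exp_conj, ← Complex.exp_add]
  rw [Complex.exp_eq_one_iff]
  exact ⟨0, by simp [xi]; ring⟩

theorem norm_wave_le {k φ : ℝ} (hk : 0 < k) (x₁ : ℝ) {x : ℂ} (hx : 0 ≤ x.im) (t : ℝ) :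
    ‖wave k (-φ) x₁ x t‖ ≤ Real.exp (-φ) := by
  rw [norm_wave]
  gcongr
  nlinarith

theorem tendsto_wave {k : ℝ} (hk : 0 < k) (s x₁ t : ℝ) :
    Tendsto (fun x => wave k s x₁ x t) (comap Complex.im atTop) (𝓝 0) := by
  rw [tendsto_zero_iff_norm_tendsto_zero]
  simp only [norm_wave]
  refine Real.tendsto_exp_atBot.comp (tendsto_atBot_add_const_right _ _ ?_)
  exact tendsto_comap.const_mul_atTop_of_neg (by linarith)

theorem one_sub_le_norm_one_add {w : ℂ} {r : ℝ} (hw : ‖w‖ ≤ r) : 1 - r ≤ ‖1 + w‖ := by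
  have := norm_sub_norm_le (1 : ℂ) (-w)
  simp only [norm_one, norm_neg, sub_neg_eq_add] at this
  linarith

theorem one_add_ne_zero_of_norm_lt {w : ℂ} (hw : ‖w‖ < 1) : 1 + w ≠ 0 := by
  have := one_sub_le_norm_one_add le_rfl (w := w)
  exact norm_pos_iff.1 (by linarith)

/-- `(1 - w)/(1 + w)` maps the disc of radius `r < 1` well inside the right half plane. -/
theorem le_re_cayley {w : ℂ} {r : ℝ} (hw : ‖w‖ ≤ r) (hr : r < 1) :
    (1 - r ^ 2) / 4 ≤ ((1 - w) / (1 + w)).re := by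
  have h0 : 1 + w ≠ 0 := one_add_ne_zero_of_norm_lt (hw.trans_lt hr)
  have hp : 0 < Complex.normSq (1 + w) := Complex.normSq_pos.2 h0
  have h1 : ((1 - w) / (1 + w)).re = (1 - ‖w‖ ^ 2) / Complex.normSq (1 + w) := by
    rw [Complex.div_re, ← add_div, ← Complex.normSq_eq_norm_sq]
    congr 1
    simp [Complex.normSq_apply]
    ring
  -- Origin of the 4 in the bound: `|1 + w| ≤ 2` on the unit disc.
  have h2 : Complex.normSq (1 + w) ≤ 4 := by
    rw [Complex.normSq_eq_norm_sq]
    have := norm_add_le 1 w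
    rw [norm_one] at this
    nlinarith [norm_nonneg (1 + w)]
  have h3 : ‖w‖ ^ 2 ≤ r ^ 2 := by gcongr
  have h4 : r ^ 2 ≤ 1 := by
    have := norm_nonneg w
    nlinarith
  rw [h1]
  gcongr
  linarith

theorem exp_neg_lt_one {φ : ℝ} (hφ : 0 < φ) : Real.exp (-φ) < 1 := by
  rw [Real.exp_lt_one_iff]
  linarith

/-! ### The periodic background. -/

section PeriodicWave

theorem hasDerivAt_one_add_wave (k s x₁ : ℝ) (x : ℂ) (t : ℝ) :
    HasDerivAt (fun z => 1 + wave k s x₁ z t) (Complex.I * k * wave k s x₁ x t) x :=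
  (hasDerivAt_wave k s x₁ x t).const_add 1

variable {k φ γ : ℝ}

/-- Since `|w|² = e^{-2φ}` on the real line, this is the amplitude relation multiplied by `|w|²`, in
the form needed for the modulus identities of both the background and the breather. -/
theorem sq_mul_wave_mul_conj (hγ : γ ^ 2 = k * (Real.exp (2 * φ) - 1)) (x₁ x t : ℝ) :
    (γ : ℂ) ^ 2 * (wave k (-φ) x₁ x t * conj (wave k (-φ) x₁ x t)) =
      k * (1 - wave k (-φ) x₁ x t * conj (wave k (-φ) x₁ x t)) := by
  have h : wave k (-φ) x₁ x t * conj (wave k (-φ) x₁ x t) = ((Real.exp (-φ) ^ 2 : ℝ) : ℂ) := by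
    rw [Complex.mul_conj', norm_wave]
    simp
  have h2 : Real.exp (2 * φ) * Real.exp (-φ) ^ 2 = 1 := by
    rw [← Real.exp_nat_mul, ← Real.exp_add, Real.exp_eq_one_iff]
    push_cast
    ring
  rw [h, ← Complex.ofReal_pow, hγ]
  norm_cast
  linear_combination k * h2

theorem isSolution_periodicWave (hk : 0 < k) (hφ : 0 < φ)
    (hγ : γ ^ 2 = k * (Real.exp (2 * φ) - 1)) (x₁ : ℝ) :
    IsSolution (-1) (periodicWave k φ γ x₁) := by
  have hr := exp_neg_lt_one hφ
  have hne : ∀ (x : ℂ) (t : ℝ), 0 ≤ x.im → 1 + wave k (-φ) x₁ x t ≠ 0 := fun x t hx =>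
    one_add_ne_zero_of_norm_lt ((norm_wave_le hk x₁ hx t).trans_lt hr)
  have hP : ∀ (t : ℝ) (z : ℂ), 1 + wave k (-φ) x₁ z t ≠ 0 →
      logSecondDeriv (1 + wave k (-φ) x₁ z t) (Complex.I * k * wave k (-φ) x₁ z t)
        (Complex.I * k * (Complex.I * k * wave k (-φ) x₁ z t)) =
      -(k ^ 2 * wave k (-φ) x₁ z t) / (1 + wave k (-φ) x₁ z t) ^ 2 := by
    intro t z hz
    unfold logSecondDeriv
    congr 1
    linear_combination (k : ℂ) ^ 2 * wave k (-φ) x₁ z t * Complex.I_mul_I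
  refine isSolution_of_bilinear k (f := fun x t => 1 + wave k (-φ) x₁ x t)
    (g := fun x t => γ * wave k (-φ) x₁ x t)
    (hasDerivAt_one_add_wave k (-φ) x₁)
    (fun x t => (hasDerivAt_wave k (-φ) x₁ x t).const_mul _)
    (fun t => fun x => (((hasDerivAt_wave k (-φ) x₁ x t).const_mul _).const_mul _).differentiableAt)
    (fun x t => (hasDerivAt_wave k (-φ) x₁ x t).const_mul _)
    (fun x t => ((hasDerivAt_wave k (-φ) x₁ x t).const_mul _).const_mul _)
    (fun x t => (hasDerivAt_wave_time k (-φ) x₁ x t).const_add _)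
    (fun x t => (hasDerivAt_wave_time k (-φ) x₁ x t).const_mul _)
    (contDiff_const.add (contDiff_wave _ _ _)) (contDiff_const.mul (contDiff_wave _ _ _))
    hne ?_ ?_ ?_ ?_
  · intro x t
    refine norm_div_sq_eq (hne x t (by simp)) ?_
    have h := sq_mul_wave_mul_conj hγ x₁ x t
    simp only [map_mul, map_add, map_one, Complex.conj_ofReal, Complex.conj_I]
    have hI := Complex.I_mul_I
    generalize conj (wave k (-φ) x₁ x t) = v at *
    generalize wave k (-φ) x₁ x t = w at *
    linear_combination h - k * (w + v + 2 * w * v) * hI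
  · intro x t
    ring
  · intro t
    refine ⟨k ^ 2 / (1 - Real.exp (-φ)) ^ 2, fun z hz => ?_⟩
    rw [hP t z (hne z t hz), norm_div, norm_neg, norm_mul, norm_pow, norm_pow, Complex.norm_real,
      Real.norm_eq_abs, sq_abs]
    have h1 := norm_wave_le (φ := φ) hk x₁ hz t
    have h2 := one_sub_le_norm_one_add h1
    have h3 : 0 < 1 - Real.exp (-φ) := by linarith
    gcongr
    exact mul_le_of_le_one_right (sq_nonneg k) (h1.trans hr.le)
  · intro t
    have hw := tendsto_wave hk (-φ) x₁ t
    have h : Tendsto (fun z => -((k : ℂ) ^ 2 * wave k (-φ) x₁ z t) / (1 + wave k (-φ) x₁ z t) ^ 2)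
        (comap Complex.im atTop) (𝓝 (-((k : ℂ) ^ 2 * 0) / (1 + 0) ^ 2)) :=
      (hw.const_mul _).neg.div ((hw.const_add 1).pow 2) (by simp)
    simp only [mul_zero, neg_zero, zero_div] at h
    refine h.congr' ?_
    filter_upwards [preimage_mem_comap (Ici_mem_atTop (0 : ℝ))] with z hz
    exact (hP t z (hne z t hz)).symm

end PeriodicWave

/-! ### Algebra of the speed, `β` and `χ`. -/

section Constants

variable {k c : ℝ}

/-- The two speed families enter the later arguments only through this sign and through `c + k ≠ 0`.
-/
theorem speed_mul_pos (hk : 0 < k) (hc : c ∈ Set.Ioi (0 : ℝ) ∨ c ∈ Set.Iio (-2 * k)) :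
    0 < c * (c + 2 * k) := by
  rcases hc with h | h
  · have h : 0 < c := h
    positivity
  · have h : c < -2 * k := h
    exact mul_pos_of_neg_of_neg (by linarith) (by linarith)

theorem speed_add_ne_zero (hk : 0 < k) (hc : c ∈ Set.Ioi (0 : ℝ) ∨ c ∈ Set.Iio (-2 * k)) :
    c + k ≠ 0 := by
  rcases hc with h | h
  · have h : 0 < c := h
    positivity
  · have h : c < -2 * k := h
    exact (by linarith : c + k < 0).ne

theorem beta_pos (hk : 0 < k) (hD : 0 < c * (c + 2 * k)) : 0 < beta k c :=
  div_pos (by linarith) hD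

/-- Partial fractions: `β ± χ` each keep a single pole in `c`. This relation and
`speed_add_mul_chi_sub_beta` drive the bilinear equation; their product is `mul_chi_sq`, which
drives the modulus identity. -/
theorem speed_mul_beta_add_chi (hD : 0 < c * (c + 2 * k)) : c * (beta k c + chi k c) = 2 := by
  have h1 : c ≠ 0 := left_ne_zero_of_mul hD.ne'
  have h2 : c + 2 * k ≠ 0 := right_ne_zero_of_mul hD.ne'
  unfold beta chi
  field_simp
  ring

theorem speed_add_mul_chi_sub_beta (hD : 0 < c * (c + 2 * k)) :
    (c + 2 * k) * (chi k c - beta k c) = 2 := by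
  have h1 : c ≠ 0 := left_ne_zero_of_mul hD.ne'
  have h2 : c + 2 * k ≠ 0 := right_ne_zero_of_mul hD.ne'
  unfold beta chi
  field_simp
  ring

theorem mul_chi_sq (hD : 0 < c * (c + 2 * k)) :
    k * chi k c ^ 2 = k * beta k c ^ 2 + 2 * beta k c := by
  have h1 : c ≠ 0 := left_ne_zero_of_mul hD.ne'
  have h2 : c + 2 * k ≠ 0 := right_ne_zero_of_mul hD.ne'
  unfold beta chi
  field_simp
  ring

end Constants

/-! ### Derivatives, bilinear identities and reflection symmetry of the breather. -/

section Derivatives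

variable (k φ γ c x₁ x₂ : ℝ)

/-- The `x`-derivative of `breatherF`. -/
noncomputable def breatherFx (x : ℂ) (t : ℝ) : ℂ :=
  -(beta k c * (Complex.I * k * wave k (-φ) x₁ x t)) - Complex.I * (1 + wave k (-φ) x₁ x t)
    + k * xi c x₂ x t * wave k (-φ) x₁ x t

/-- The second `x`-derivative of `breatherF`. -/
noncomputable def breatherFxx (x : ℂ) (t : ℝ) : ℂ :=
  (k ^ 2 * beta k c + 2 * k + Complex.I * k ^ 2 * xi c x₂ x t) * wave k (-φ) x₁ x t

/-- The `x`-derivative of `breatherG`. -/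
noncomputable def breatherGx (x : ℂ) (t : ℝ) : ℂ :=
  γ * wave k (-φ) x₁ x t *
    (Complex.I * k * (chi k c - Complex.I * xi c x₂ x t) - Complex.I)

/-- The second `x`-derivative of `breatherG`. -/
noncomputable def breatherGxx (x : ℂ) (t : ℝ) : ℂ :=
  γ * wave k (-φ) x₁ x t * (-k ^ 2 * (chi k c - Complex.I * xi c x₂ x t) + 2 * k)

/-- The `t`-derivative of `breatherF`. -/
noncomputable def breatherFt' (x : ℂ) (t : ℝ) : ℂ :=
  -(beta k c * (Complex.I * k ^ 2 * wave k (-φ) x₁ x t))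
    + Complex.I * c * (1 + wave k (-φ) x₁ x t) + k ^ 2 * xi c x₂ x t * wave k (-φ) x₁ x t

/-- The `t`-derivative of `breatherG`. -/
noncomputable def breatherGt' (x : ℂ) (t : ℝ) : ℂ :=
  γ * wave k (-φ) x₁ x t *
    (Complex.I * k ^ 2 * (chi k c - Complex.I * xi c x₂ x t) + Complex.I * c)

variable (x : ℂ) (t : ℝ)

theorem hasDerivAt_breatherF :
    HasDerivAt (fun z => breatherF k φ c x₁ x₂ z t) (breatherFx k φ c x₁ x₂ x t) x := by
  have hw := hasDerivAt_wave k (-φ) x₁ x t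
  have hxi := hasDerivAt_xi c x₂ x t
  refine (((hw.const_sub 1).const_mul (beta k c : ℂ)).fun_sub
    ((hxi.const_mul Complex.I).fun_mul (hw.const_add 1))).congr_deriv ?_
  unfold breatherFx
  linear_combination -(k * xi c x₂ x t * wave k (-φ) x₁ x t) * Complex.I_mul_I

theorem hasDerivAt_breatherFx :
    HasDerivAt (fun z => breatherFx k φ c x₁ x₂ z t) (breatherFxx k φ c x₁ x₂ x t) x := by
  have hw := hasDerivAt_wave k (-φ) x₁ x t
  have hxi := hasDerivAt_xi c x₂ x t
  refine ((((hw.const_mul (Complex.I * k)).const_mul (beta k c : ℂ)).fun_neg.fun_sub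
    ((hw.const_add 1).const_mul Complex.I)).fun_add
    ((hxi.const_mul (k : ℂ)).fun_mul hw)).congr_deriv ?_
  unfold breatherFxx
  linear_combination -((k ^ 2 * beta k c + k) * wave k (-φ) x₁ x t) * Complex.I_mul_I

theorem hasDerivAt_breatherG :
    HasDerivAt (fun z => breatherG k φ γ c x₁ x₂ z t) (breatherGx k φ γ c x₁ x₂ x t) x := by
  have hw := hasDerivAt_wave k (-φ) x₁ x t
  have hxi := hasDerivAt_xi c x₂ x t
  refine ((hw.const_mul (γ : ℂ)).fun_mul
    ((hxi.const_mul Complex.I).const_sub (chi k c : ℂ))).congr_deriv ?_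
  unfold breatherGx
  ring

theorem hasDerivAt_breatherGx :
    HasDerivAt (fun z => breatherGx k φ γ c x₁ x₂ z t) (breatherGxx k φ γ c x₁ x₂ x t) x := by
  have hw := hasDerivAt_wave k (-φ) x₁ x t
  have hxi := hasDerivAt_xi c x₂ x t
  refine ((hw.const_mul (γ : ℂ)).fun_mul
    ((((hxi.const_mul Complex.I).const_sub (chi k c : ℂ)).const_mul
      (Complex.I * k)).sub_const Complex.I)).congr_deriv ?_
  unfold breatherGxx
  linear_combination (γ * wave k (-φ) x₁ x t *
    (k ^ 2 * (chi k c - Complex.I * xi c x₂ x t) - 2 * k)) * Complex.I_mul_I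

theorem hasDerivAt_breatherF_time :
    HasDerivAt (fun s => breatherF k φ c x₁ x₂ x s) (breatherFt' k φ c x₁ x₂ x t) t := by
  have hw := hasDerivAt_wave_time k (-φ) x₁ x t
  have hxi := hasDerivAt_xi_time c x₂ x t
  refine (((hw.const_sub 1).const_mul (beta k c : ℂ)).fun_sub
    ((hxi.const_mul Complex.I).fun_mul (hw.const_add 1))).congr_deriv ?_
  unfold breatherFt'
  linear_combination -(k ^ 2 * xi c x₂ x t * wave k (-φ) x₁ x t) * Complex.I_mul_I

theorem hasDerivAt_breatherG_time :
    HasDerivAt (fun s => breatherG k φ γ c x₁ x₂ x s) (breatherGt' k φ γ c x₁ x₂ x t) t := by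
  have hw := hasDerivAt_wave_time k (-φ) x₁ x t
  have hxi := hasDerivAt_xi_time c x₂ x t
  refine ((hw.const_mul (γ : ℂ)).fun_mul
    ((hxi.const_mul Complex.I).const_sub (chi k c : ℂ))).congr_deriv ?_
  unfold breatherGt'
  ring

theorem differentiable_breatherFxx : Differentiable ℂ (fun z => breatherFxx k φ c x₁ x₂ z t) :=
  fun x => ((((hasDerivAt_xi c x₂ x t).const_mul _).const_add _).mul
    (hasDerivAt_wave k (-φ) x₁ x t)).differentiableAt

theorem contDiff_breatherF :
    ContDiff ℝ ∞ (fun p : ℝ × ℝ => breatherF k φ c x₁ x₂ p.1 p.2) :=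
  (contDiff_const.mul (contDiff_const.sub (contDiff_wave k (-φ) x₁))).sub
    ((contDiff_const.mul (contDiff_xi c x₂)).mul (contDiff_const.add (contDiff_wave k (-φ) x₁)))

theorem contDiff_breatherG :
    ContDiff ℝ ∞ (fun p : ℝ × ℝ => breatherG k φ γ c x₁ x₂ p.1 p.2) :=
  (contDiff_const.mul (contDiff_wave k (-φ) x₁)).mul
    (contDiff_const.sub (contDiff_const.mul (contDiff_xi c x₂)))

theorem breather_bilinear (hD : 0 < c * (c + 2 * k)) :
    Complex.I * (breatherGt' k φ γ c x₁ x₂ x t * breatherF k φ c x₁ x₂ x t -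
        breatherG k φ γ c x₁ x₂ x t * breatherFt' k φ c x₁ x₂ x t) =
      breatherGxx k φ γ c x₁ x₂ x t * breatherF k φ c x₁ x₂ x t -
        2 * breatherGx k φ γ c x₁ x₂ x t * breatherFx k φ c x₁ x₂ x t +
        breatherG k φ γ c x₁ x₂ x t * breatherFxx k φ c x₁ x₂ x t := by
  have h1 : (c : ℂ) * (beta k c + chi k c) = 2 := by exact_mod_cast speed_mul_beta_add_chi hD
  have h2 : ((c : ℂ) + 2 * k) * (chi k c - beta k c) = 2 := by
    exact_mod_cast speed_add_mul_chi_sub_beta hD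
  have hI := Complex.I_mul_I
  unfold breatherG breatherF breatherGx breatherGxx breatherFx breatherFxx breatherFt' breatherGt'
  generalize wave k (-φ) x₁ x t = w
  generalize xi c x₂ x t = ξ
  generalize (beta k c : ℂ) = b at *
  generalize (chi k c : ℂ) = d at *
  grind

/-- `f' f̃ - f̃' f` is, up to the factor `i`, the product `g g̃`. -/
theorem breatherG_mul_breatherGt (hD : 0 < c * (c + 2 * k))
    (hγ : γ ^ 2 = k * (Real.exp (2 * φ) - 1)) :
    breatherG k φ γ c x₁ x₂ x t * breatherGt k γ c x₂ x t =
      Complex.I * (breatherFx k φ c x₁ x₂ x t * breatherFt k φ c x₁ x₂ x t -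
        breatherFx k (-φ) c x₁ x₂ x t * breatherF k φ c x₁ x₂ x t) := by
  have h1 : (k : ℂ) * chi k c ^ 2 = k * beta k c ^ 2 + 2 * beta k c := by
    exact_mod_cast mul_chi_sq hD
  have h2 : (γ : ℂ) ^ 2 * wave k (-φ) x₁ x t = k * (wave k φ x₁ x t - wave k (-φ) x₁ x t) := by
    have : wave k φ x₁ x t = Real.exp (2 * φ) * wave k (-φ) x₁ x t := by
      rw [← wave_add]
      congr 1
      ring
    rw [this, ← Complex.ofReal_pow, hγ]
    push_cast
    ring
  have hI := Complex.I_mul_I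
  unfold breatherG breatherF breatherGt breatherFt breatherFx
  rw [neg_neg]
  generalize wave k (-φ) x₁ x t = w at *
  generalize wave k φ x₁ x t = v at *
  generalize xi c x₂ x t = ξ
  generalize (beta k c : ℂ) = b at *
  generalize (chi k c : ℂ) = d at *
  grind

theorem conj_xi : conj (xi c x₂ (conj x) t) = xi c x₂ x t := by
  simp [xi]

/-- The phase `ξ₂` is invariant under reflection, while the exponential is inverted. So zeros of
`f̃` mirror those of `f`, and the nonvanishing factor cancels against the one for `g` in
`conj_breather`. -/
theorem conj_breatherF_mul :
    conj (breatherF k φ c x₁ x₂ (conj x) t) * wave k φ x₁ x t =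
      -breatherFt k φ c x₁ x₂ x t := by
  have h := conj_wave_mul k φ x₁ x t
  have h2 := conj_xi c x₂ x t
  simp only [breatherF, breatherFt, map_mul, map_sub, map_add, map_one, Complex.conj_ofReal,
    Complex.conj_I, h2]
  linear_combination (-beta k c + Complex.I * xi c x₂ x t) * h

theorem conj_breatherG_mul :
    conj (breatherG k φ γ c x₁ x₂ (conj x) t) * wave k φ x₁ x t = -breatherGt k γ c x₂ x t := by
  have h := conj_wave_mul k φ x₁ x t
  have h2 := conj_xi c x₂ x t
  simp only [breatherG, breatherGt, map_mul, map_sub, Complex.conj_ofReal,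
    Complex.conj_I, h2]
  linear_combination γ * (chi k c + Complex.I * xi c x₂ x t) * h

theorem conj_breather (x : ℝ) :
    conj (breatherG k φ γ c x₁ x₂ x t / breatherF k φ c x₁ x₂ x t) =
      breatherGt k γ c x₂ x t / breatherFt k φ c x₁ x₂ x t := by
  have hw : wave k φ x₁ x t ≠ 0 := Complex.exp_ne_zero _
  have h1 := conj_breatherF_mul k φ c x₁ x₂ x t
  have h2 := conj_breatherG_mul k φ γ c x₁ x₂ x t
  rw [Complex.conj_ofReal] at h1 h2
  rw [← neg_div_neg_eq (breatherGt k γ c x₂ x t), ← h1, ← h2, mul_div_mul_right _ _ hw, map_div₀]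

end Derivatives

/-! ### Zeros, solution property and asymptotics of the breather. -/

section Breather

variable {k φ γ c : ℝ} (x₁ x₂ : ℝ)

/-- The quotient of `breatherF` by `1 + w`, with `w` the background wave. -/
noncomputable def breatherRatio (k φ c x₁ x₂ : ℝ) (x : ℂ) (t : ℝ) : ℂ :=
  beta k c * ((1 - wave k (-φ) x₁ x t) / (1 + wave k (-φ) x₁ x t)) - Complex.I * xi c x₂ x t

theorem one_add_wave_ne_zero (hk : 0 < k) (hφ : 0 < φ) {x : ℂ} (hx : 0 ≤ x.im) (t : ℝ) :
    1 + wave k (-φ) x₁ x t ≠ 0 :=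
  one_add_ne_zero_of_norm_lt ((norm_wave_le hk x₁ hx t).trans_lt (exp_neg_lt_one hφ))

theorem breatherF_eq_mul {x : ℂ} {t : ℝ} (h : 1 + wave k (-φ) x₁ x t ≠ 0) :
    breatherF k φ c x₁ x₂ x t = (1 + wave k (-φ) x₁ x t) * breatherRatio k φ c x₁ x₂ x t := by
  unfold breatherF breatherRatio
  field_simp

/-- Here `β > 0` multiplies the Cayley bound, and `Re(-i ξ₂) = Im x`. The constant term excludes
zeros and bounds `1/L`; the term `Im x` makes `1/L` decay. -/
theorem le_re_breatherRatio (hk : 0 < k) (hφ : 0 < φ) (hD : 0 < c * (c + 2 * k)) {x : ℂ}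
    (hx : 0 ≤ x.im) (t : ℝ) :
    beta k c * ((1 - Real.exp (-φ) ^ 2) / 4) + x.im ≤ (breatherRatio k φ c x₁ x₂ x t).re := by
  have h1 := le_re_cayley (norm_wave_le (φ := φ) hk x₁ hx t) (exp_neg_lt_one hφ)
  have h2 := mul_le_mul_of_nonneg_left h1 (beta_pos hk hD).le
  simpa [breatherRatio, xi] using h2

theorem breatherRatio_bound_pos (hk : 0 < k) (hφ : 0 < φ) (hD : 0 < c * (c + 2 * k)) :
    0 < beta k c * ((1 - Real.exp (-φ) ^ 2) / 4) := by
  have h1 := exp_neg_lt_one hφ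
  have h2 := Real.exp_pos (-φ)
  have h3 : 0 < 1 - Real.exp (-φ) ^ 2 := by nlinarith
  have h4 := beta_pos hk hD
  positivity

theorem le_norm_breatherRatio (hk : 0 < k) (hφ : 0 < φ) (hD : 0 < c * (c + 2 * k)) {x : ℂ}
    (hx : 0 ≤ x.im) (t : ℝ) :
    beta k c * ((1 - Real.exp (-φ) ^ 2) / 4) + x.im ≤ ‖breatherRatio k φ c x₁ x₂ x t‖ :=
  (le_re_breatherRatio x₁ x₂ hk hφ hD hx t).trans (Complex.re_le_norm _)

theorem breatherRatio_ne_zero (hk : 0 < k) (hφ : 0 < φ) (hD : 0 < c * (c + 2 * k)) {x : ℂ}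
    (hx : 0 ≤ x.im) (t : ℝ) : breatherRatio k φ c x₁ x₂ x t ≠ 0 := by
  have := le_norm_breatherRatio x₁ x₂ hk hφ hD hx t
  have := breatherRatio_bound_pos hk hφ hD
  exact norm_pos_iff.1 (by linarith)

theorem breatherF_ne_zero (hk : 0 < k) (hφ : 0 < φ) (hD : 0 < c * (c + 2 * k)) {x : ℂ}
    (hx : 0 ≤ x.im) (t : ℝ) : breatherF k φ c x₁ x₂ x t ≠ 0 := by
  rw [breatherF_eq_mul x₁ x₂ (one_add_wave_ne_zero x₁ hk hφ hx t)]
  exact mul_ne_zero (one_add_wave_ne_zero x₁ hk hφ hx t)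
    (breatherRatio_ne_zero x₁ x₂ hk hφ hD hx t)

theorem breatherFt_ne_zero (hk : 0 < k) (hφ : 0 < φ) (hD : 0 < c * (c + 2 * k)) {x : ℂ}
    (hx : x.im ≤ 0) (t : ℝ) : breatherFt k φ c x₁ x₂ x t ≠ 0 := by
  rw [← neg_ne_zero, ← conj_breatherF_mul]
  refine mul_ne_zero ?_ (Complex.exp_ne_zero _)
  rw [map_ne_zero]
  exact breatherF_ne_zero x₁ x₂ hk hφ hD (by simpa using hx) t

/-- `(log f)''` as a polynomial in `w`, `1/(1+w)` and the inverse of `breatherRatio`. -/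
theorem logSecondDeriv_breatherF {x : ℂ} {t : ℝ} (hw : 1 + wave k (-φ) x₁ x t ≠ 0)
    (hL : breatherRatio k φ c x₁ x₂ x t ≠ 0) :
    logSecondDeriv (breatherF k φ c x₁ x₂ x t) (breatherFx k φ c x₁ x₂ x t)
        (breatherFxx k φ c x₁ x₂ x t) =
      -k ^ 2 * wave k (-φ) x₁ x t * (1 + wave k (-φ) x₁ x t)⁻¹ ^ 2 +
      beta k c * 2 * k ^ 2 * wave k (-φ) x₁ x t * (1 - wave k (-φ) x₁ x t) *
        (1 + wave k (-φ) x₁ x t)⁻¹ ^ 3 * (breatherRatio k φ c x₁ x₂ x t)⁻¹ -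
      (-2 * Complex.I * k * beta k c * wave k (-φ) x₁ x t * (1 + wave k (-φ) x₁ x t)⁻¹ ^ 2 -
        Complex.I) ^ 2 * (breatherRatio k φ c x₁ x₂ x t)⁻¹ ^ 2 := by
  have hf := breatherF_eq_mul x₁ x₂ (c := c) hw
  have hf0 : breatherF k φ c x₁ x₂ x t ≠ 0 := by
    rw [hf]
    exact mul_ne_zero hw hL
  have hb : (breatherRatio k φ c x₁ x₂ x t)⁻¹ =
      (1 + wave k (-φ) x₁ x t) / breatherF k φ c x₁ x₂ x t := by
    rw [hf]
    field_simp
  rw [hb]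
  unfold logSecondDeriv
  have hI := Complex.I_mul_I
  field_simp
  unfold breatherF breatherFx breatherFxx
  generalize wave k (-φ) x₁ x t = w at *
  generalize xi c x₂ x t = ξ
  generalize (beta k c : ℂ) = b at *
  grind

theorem isSolution_breather (hk : 0 < k) (hφ : 0 < φ) (hD : 0 < c * (c + 2 * k))
    (hγ : γ ^ 2 = k * (Real.exp (2 * φ) - 1)) :
    IsSolution (-1) (fun x t : ℝ => breatherG k φ γ c x₁ x₂ x t / breatherF k φ c x₁ x₂ x t) := by
  -- In these variables `(log f)''` is a polynomial. They stay in a compact set for `Im x ≥ 0`,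
  -- which gives boundedness, and tend to `(0, 1, 0)`, a zero of `Q`, which gives decay.
  set Q : ℂ × ℂ × ℂ → ℂ := fun q => -k ^ 2 * q.1 * q.2.1 ^ 2 +
    beta k c * 2 * k ^ 2 * q.1 * (1 - q.1) * q.2.1 ^ 3 * q.2.2 -
    (-2 * Complex.I * k * beta k c * q.1 * q.2.1 ^ 2 - Complex.I) ^ 2 * q.2.2 ^ 2 with hQ
  have hQc : Continuous Q := by fun_prop
  have hP : ∀ (x : ℂ) (t : ℝ), 0 ≤ x.im →
      logSecondDeriv (breatherF k φ c x₁ x₂ x t) (breatherFx k φ c x₁ x₂ x t)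
        (breatherFxx k φ c x₁ x₂ x t) = Q (wave k (-φ) x₁ x t, (1 + wave k (-φ) x₁ x t)⁻¹,
          (breatherRatio k φ c x₁ x₂ x t)⁻¹) := fun x t hx =>
    logSecondDeriv_breatherF x₁ x₂ (one_add_wave_ne_zero x₁ hk hφ hx t)
      (breatherRatio_ne_zero x₁ x₂ hk hφ hD hx t)
  refine isSolution_of_bilinear k (hasDerivAt_breatherF k φ c x₁ x₂)
    (hasDerivAt_breatherFx k φ c x₁ x₂) (differentiable_breatherFxx k φ c x₁ x₂)
    (hasDerivAt_breatherG k φ γ c x₁ x₂) (hasDerivAt_breatherGx k φ γ c x₁ x₂)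
    (hasDerivAt_breatherF_time k φ c x₁ x₂) (hasDerivAt_breatherG_time k φ γ c x₁ x₂)
    (contDiff_breatherF k φ c x₁ x₂) (contDiff_breatherG k φ γ c x₁ x₂)
    (fun x t hx => breatherF_ne_zero x₁ x₂ hk hφ hD hx t) ?_
    (fun x t => breather_bilinear k φ γ c x₁ x₂ x t hD) ?_ ?_
  · intro x t
    refine norm_div_sq_eq (breatherF_ne_zero x₁ x₂ hk hφ hD (by simp) t) ?_
    have h := sq_mul_wave_mul_conj hγ x₁ x t
    have h1 : (k : ℂ) * chi k c ^ 2 = k * beta k c ^ 2 + 2 * beta k c := by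
      exact_mod_cast mul_chi_sq hD
    have hxi : conj (xi c x₂ x t) = xi c x₂ x t := by simp [xi]
    have hI := Complex.I_mul_I
    simp only [breatherG, breatherF, breatherFx, map_mul, map_add, map_sub, map_neg, map_one,
      Complex.conj_ofReal, Complex.conj_I, hxi]
    generalize conj (wave k (-φ) x₁ x t) = v at *
    generalize wave k (-φ) x₁ x t = w at *
    generalize xi c x₂ x t = ξ
    generalize (beta k c : ℂ) = b at *
    generalize (chi k c : ℂ) = d at *
    grind
  · intro t
    obtain ⟨C, hC⟩ := ((isCompact_closedBall (0 : ℂ) 1).prod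
      ((isCompact_closedBall (0 : ℂ) (1 - Real.exp (-φ))⁻¹).prod (isCompact_closedBall (0 : ℂ)
        (beta k c * ((1 - Real.exp (-φ) ^ 2) / 4))⁻¹))).exists_bound_of_continuousOn
      hQc.continuousOn
    refine ⟨C, fun z hz => ?_⟩
    rw [hP z t hz]
    have hw := norm_wave_le (φ := φ) hk x₁ hz t
    have hr := exp_neg_lt_one hφ
    refine hC _ ⟨?_, ?_, ?_⟩ <;> simp only [mem_closedBall_zero_iff]
    · exact hw.trans hr.le
    · rw [norm_inv]
      exact inv_anti₀ (by linarith) (one_sub_le_norm_one_add hw)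
    · rw [norm_inv]
      refine inv_anti₀ (breatherRatio_bound_pos hk hφ hD) ?_
      have := le_norm_breatherRatio x₁ x₂ hk hφ hD hz t
      linarith
  · intro t
    have him : ∀ᶠ z : ℂ in comap Complex.im atTop, 0 ≤ z.im :=
      preimage_mem_comap (Ici_mem_atTop (0 : ℝ))
    have hw := tendsto_wave hk (-φ) x₁ t
    have ha : Tendsto (fun z => (1 + wave k (-φ) x₁ z t)⁻¹) (comap Complex.im atTop)
        (𝓝 (1 + 0)⁻¹) := (hw.const_add 1).inv₀ (by simp)
    have hL : Tendsto (fun z => ‖breatherRatio k φ c x₁ x₂ z t‖) (comap Complex.im atTop)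
        atTop := by
      refine tendsto_atTop_mono' _ ?_ tendsto_comap
      filter_upwards [him] with z hz
      have := le_norm_breatherRatio x₁ x₂ hk hφ hD hz t
      have := breatherRatio_bound_pos hk hφ hD
      linarith
    have hb := tendsto_inv₀_cobounded.comp (tendsto_norm_atTop_iff_cobounded.1 hL)
    have h := (hQc.tendsto _).comp (hw.prodMk_nhds (ha.prodMk_nhds hb))
    have h0 : Q (0, (1 + 0)⁻¹, 0) = 0 := by simp [hQ]
    rw [h0] at h
    refine h.congr' ?_
    filter_upwards [him] with z hz
    exact (hP z t hz).symm

/-- Write `g = γ w (χ - β (1 - w)/(1 + w) + L)` and `f = (1 + w) L`: the summand `L` reproduces the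
background, leaving a bounded factor times `1/L`. -/
theorem breather_sub_periodicWave (hk : 0 < k) (hφ : 0 < φ) (hD : 0 < c * (c + 2 * k)) (x t : ℝ) :
    breatherG k φ γ c x₁ x₂ x t / breatherF k φ c x₁ x₂ x t - periodicWave k φ γ x₁ x t =
      γ * wave k (-φ) x₁ x t * (1 + wave k (-φ) x₁ x t)⁻¹ *
        (chi k c - beta k c * ((1 - wave k (-φ) x₁ x t) * (1 + wave k (-φ) x₁ x t)⁻¹)) *
        (breatherRatio k φ c x₁ x₂ x t)⁻¹ := by
  have hw := one_add_wave_ne_zero x₁ hk hφ (x := x) (by simp) t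
  have hL := breatherRatio_ne_zero x₁ x₂ hk hφ hD (x := x) (by simp) t
  have h : breatherG k φ γ c x₁ x₂ x t = γ * wave k (-φ) x₁ x t * (chi k c -
      beta k c * ((1 - wave k (-φ) x₁ x t) * (1 + wave k (-φ) x₁ x t)⁻¹) +
      breatherRatio k φ c x₁ x₂ x t) := by
    unfold breatherG breatherRatio
    rw [div_eq_mul_inv]
    ring
  rw [h, breatherF_eq_mul x₁ x₂ hw, periodicWave]
  field_simp
  ring

theorem breather_ne_periodicWave (hk : 0 < k) (hφ : 0 < φ) (hD : 0 < c * (c + 2 * k))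
    (hγ : γ ≠ 0) (t : ℝ) :
    ∃ x : ℝ, breatherG k φ γ c x₁ x₂ x t / breatherF k φ c x₁ x₂ x t ≠
      periodicWave k φ γ x₁ x t := by
  -- Chosen so that `k ξ₁ = π/2`, hence `w = i e^{-φ}`. Equality would then force `χ = β` (real
  -- part) and `χ = -β` (imaginary part), against `β > 0`.
  refine ⟨Real.pi / (2 * k) - k * t + x₁, ?_⟩
  rw [← sub_ne_zero, breather_sub_periodicWave x₁ x₂ hk hφ hD]
  have hw := one_add_wave_ne_zero x₁ hk hφ
    (x := ((Real.pi / (2 * k) - k * t + x₁ : ℝ) : ℂ)) (Complex.ofReal_im _).ge t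
  have hL := breatherRatio_ne_zero x₁ x₂ hk hφ hD
    (x := ((Real.pi / (2 * k) - k * t + x₁ : ℝ) : ℂ)) (Complex.ofReal_im _).ge t
  have hval : wave k (-φ) x₁ ((Real.pi / (2 * k) - k * t + x₁ : ℝ) : ℂ) t =
      Real.exp (-φ) * Complex.I := by
    have hk' : (k : ℂ) ≠ 0 := by exact_mod_cast hk.ne'
    have harg : Complex.I * k * xi (-k) x₁ ((Real.pi / (2 * k) - k * t + x₁ : ℝ) : ℂ) t +
        ((-φ : ℝ) : ℂ) = ((-φ : ℝ) : ℂ) + Real.pi / 2 * Complex.I := by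
      unfold xi
      push_cast
      field_simp
      ring
    rw [wave, harg, Complex.exp_add, Complex.exp_pi_div_two_mul_I, Complex.ofReal_exp]
  have hw0 : wave k (-φ) x₁ ((Real.pi / (2 * k) - k * t + x₁ : ℝ) : ℂ) t ≠ 0 :=
    Complex.exp_ne_zero _
  refine mul_ne_zero (mul_ne_zero (mul_ne_zero (mul_ne_zero (by exact_mod_cast hγ) hw0)
    (inv_ne_zero hw)) ?_) (inv_ne_zero hL)
  intro h0
  rw [hval] at h0 hw
  have h1 : (chi k c : ℂ) * (1 + Real.exp (-φ) * Complex.I) -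
      beta k c * (1 - Real.exp (-φ) * Complex.I) = 0 := by
    field_simp at h0
    linear_combination h0
  have hb := beta_pos hk hD
  have hr := Real.exp_pos (-φ)
  generalize Real.exp (-φ) = r at *
  have hre := congrArg Complex.re h1
  have him := congrArg Complex.im h1
  simp only [Complex.sub_re, Complex.sub_im, Complex.mul_re, Complex.mul_im, Complex.add_re,
    Complex.add_im, Complex.one_re, Complex.one_im, Complex.ofReal_re, Complex.ofReal_im,
    Complex.I_re, Complex.I_im, Complex.zero_re, Complex.zero_im] at hre him
  nlinarith [mul_pos hb hr]

theorem tendsto_breather_sub_periodicWave (hk : 0 < k) (hφ : 0 < φ) (hD : 0 < c * (c + 2 * k)) :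
    Tendsto (fun p : ℝ × ℝ => breatherG k φ γ c x₁ x₂ p.1 p.2 / breatherF k φ c x₁ x₂ p.1 p.2 -
        periodicWave k φ γ x₁ p.1 p.2)
      (comap (fun p : ℝ × ℝ => p.1 - c * p.2) (Bornology.cobounded ℝ)) (𝓝 0) := by
  have hr := exp_neg_lt_one hφ
  have hr' : 0 < 1 - Real.exp (-φ) := by linarith
  have hw : ∀ p : ℝ × ℝ, ‖wave k (-φ) x₁ p.1 p.2‖ ≤ Real.exp (-φ) := fun p =>
    norm_wave_le hk x₁ (by simp) p.2
  have ha : ∀ p : ℝ × ℝ, ‖(1 + wave k (-φ) x₁ p.1 p.2)⁻¹‖ ≤ (1 - Real.exp (-φ))⁻¹ := fun p => by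
    rw [norm_inv]
    exact inv_anti₀ hr' (one_sub_le_norm_one_add (hw p))
  obtain ⟨B, hB⟩ : ∃ B : ℝ, ∀ p : ℝ × ℝ, ‖(beta k c : ℂ) * ((1 - wave k (-φ) x₁ p.1 p.2) *
      (1 + wave k (-φ) x₁ p.1 p.2)⁻¹)‖ ≤ B := by
    refine ⟨‖(beta k c : ℂ)‖ * (2 * (1 - Real.exp (-φ))⁻¹), fun p => ?_⟩
    rw [norm_mul, norm_mul]
    have : ‖1 - wave k (-φ) x₁ p.1 p.2‖ ≤ 2 := by
      refine (norm_sub_le _ _).trans ?_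
      have := hw p
      rw [norm_one]
      linarith
    have := ha p
    gcongr
  have hL : Tendsto (fun p : ℝ × ℝ => ‖breatherRatio k φ c x₁ x₂ p.1 p.2‖)
      (comap (fun p : ℝ × ℝ => p.1 - c * p.2) (Bornology.cobounded ℝ)) atTop := by
    have h1 := tendsto_norm_cobounded_atTop.comp
      (tendsto_comap (f := fun p : ℝ × ℝ => p.1 - c * p.2) (x := Bornology.cobounded ℝ))
    -- `|L| ≥ |x - c t| - |x₂| - B`, because the Cayley term is bounded by `B` uniformly in `x` and
    -- `t`.
    refine tendsto_atTop_mono (fun p => ?_) (tendsto_atTop_add_const_right _ (-|x₂| - B) h1)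
    have h2 := norm_sub_norm_le (Complex.I * xi c x₂ p.1 p.2) ((beta k c : ℂ) *
      ((1 - wave k (-φ) x₁ p.1 p.2) * (1 + wave k (-φ) x₁ p.1 p.2)⁻¹))
    have h3 : ‖Complex.I * xi c x₂ p.1 p.2‖ = |p.1 - c * p.2 - x₂| := by
      rw [norm_mul, Complex.norm_I, one_mul, xi, ← Real.norm_eq_abs, ← Complex.norm_real]
      push_cast
      rfl
    have h4 := abs_sub_abs_le_abs_sub (p.1 - c * p.2) x₂
    have h5 := hB p
    rw [norm_sub_rev, h3] at h2
    simp only [Function.comp_apply, Real.norm_eq_abs, breatherRatio, div_eq_mul_inv]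
    linarith
  have hb := tendsto_inv₀_cobounded.comp (tendsto_norm_atTop_iff_cobounded.1 hL)
  have hb' := (hb.norm).const_mul
    (‖(γ : ℂ)‖ * 1 * (1 - Real.exp (-φ))⁻¹ * (‖(chi k c : ℂ)‖ + B))
  rw [norm_zero, mul_zero] at hb'
  refine squeeze_zero_norm (fun p => ?_) hb'
  rw [breather_sub_periodicWave x₁ x₂ hk hφ hD, norm_mul, norm_mul, norm_mul, norm_mul]
  have h1 := (hw p).trans hr.le
  have h2 := ha p
  have h3 := (norm_sub_le (chi k c : ℂ) ((beta k c : ℂ) * ((1 - wave k (-φ) x₁ p.1 p.2) *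
      (1 + wave k (-φ) x₁ p.1 p.2)⁻¹))).trans (add_le_add_right (hB p) _)
  simp only [Function.comp_apply]
  gcongr

theorem breather_recurrent (hk : 0 < k) (hc : c + k ≠ 0) :
    ∃ T : ℝ, 0 < T ∧ ∀ x t : ℝ,
      breatherG k φ γ c x₁ x₂ (x + c * T : ℝ) (t + T) / breatherF k φ c x₁ x₂ (x + c * T : ℝ) (t + T) =
        breatherG k φ γ c x₁ x₂ x t / breatherF k φ c x₁ x₂ x t := by
  -- In the frame of speed `c` the phase `ξ₂` is constant and `k ξ₁` advances at rate `k (c + k)`,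
  -- so `T` is one turn of `w`.
  refine ⟨2 * Real.pi / (k * |c + k|), by positivity, fun x t => ?_⟩
  set T : ℝ := 2 * Real.pi / (k * |c + k|) with hT
  have hxi : xi c x₂ (x + c * T : ℝ) (t + T) = xi c x₂ x t := by
    simp only [xi]
    push_cast
    ring
  obtain ⟨n, hn⟩ : ∃ n : ℤ, k * (c + k) * T = n * (2 * Real.pi) := by
    rcases lt_or_gt_of_ne hc with h | h
    · refine ⟨-1, ?_⟩
      rw [hT, abs_of_neg h]
      push_cast
      field_simp
    · refine ⟨1, ?_⟩
      rw [hT, abs_of_pos h]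
      push_cast
      field_simp
  have hn' : (k : ℂ) * (c + k) * T = n * (2 * Real.pi) := by exact_mod_cast hn
  have hwave : wave k (-φ) x₁ (x + c * T : ℝ) (t + T) = wave k (-φ) x₁ x t := by
    unfold wave
    rw [Complex.exp_eq_exp_iff_exists_int]
    refine ⟨n, ?_⟩
    unfold xi
    push_cast
    linear_combination Complex.I * hn'
  simp only [breatherG, breatherF, hxi, hwave]

theorem isBreatherOn_breather (hk : 0 < k) (hφ : 0 < φ) (hD : 0 < c * (c + 2 * k))
    (hc : c + k ≠ 0) (hγ : γ ^ 2 = k * (Real.exp (2 * φ) - 1)) (hγ0 : γ ≠ 0) :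
    IsBreatherOn (-1) (periodicWave k φ γ x₁) c
      (fun x t : ℝ => breatherG k φ γ c x₁ x₂ x t / breatherF k φ c x₁ x₂ x t) where
  background := isSolution_periodicWave hk hφ hγ x₁
  solution := isSolution_breather x₁ x₂ hk hφ hD hγ
  differs := breather_ne_periodicWave x₁ x₂ hk hφ hD hγ0
  asymptotic := tendsto_breather_sub_periodicWave x₁ x₂ hk hφ hD
  recurrent := breather_recurrent x₁ x₂ hk hc

theorem norm_sq_breather (hk : 0 < k) (hφ : 0 < φ) (hD : 0 < c * (c + 2 * k))
    (hγ : γ ^ 2 = k * (Real.exp (2 * φ) - 1)) (x t : ℝ) :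
    ((‖breatherG k φ γ c x₁ x₂ x t / breatherF k φ c x₁ x₂ x t‖ ^ 2 : ℝ) : ℂ) =
      Complex.I * logDeriv (fun y : ℝ => breatherF k φ c x₁ x₂ y t /
        breatherFt k φ c x₁ x₂ y t) x := by
  have hf := breatherF_ne_zero x₁ x₂ hk hφ hD (x := x) (by simp) t
  have hft := breatherFt_ne_zero x₁ x₂ hk hφ hD (x := x) (by simp) t
  have h1 : HasDerivAt (fun y : ℝ => breatherF k φ c x₁ x₂ y t) (breatherFx k φ c x₁ x₂ x t) x :=
    (hasDerivAt_breatherF k φ c x₁ x₂ x t).comp_ofReal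
  have h2 : HasDerivAt (fun y : ℝ => breatherFt k φ c x₁ x₂ y t)
      (breatherFx k (-φ) c x₁ x₂ x t) x := by
    have := (hasDerivAt_breatherF k (-φ) c x₁ x₂ x t).comp_ofReal
    simpa only [breatherF, breatherFt, neg_neg] using this
  rw [logDeriv_apply, (h1.fun_div h2 hft).deriv, Complex.ofReal_pow, ← Complex.mul_conj',
    conj_breather]
  have := breatherG_mul_breatherGt k φ γ c x₁ x₂ x t hD hγ
  field_simp
  linear_combination this

end Breather

/-! ### The long-wave limit. -/

section LongWave

variable {k c : ℝ}

theorem A12_zero (hD : 0 < c * (c + 2 * k)) : A12 k 0 c = 0 := by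
  have h : (-k - c) ^ 2 - k ^ 2 ≠ 0 := by
    convert hD.ne' using 1
    ring
  rw [A12, add_zero, sub_zero, div_self h, Real.log_one, neg_zero]

/-- `e^{-A₁₂/2} = 1 - β₁₂ k₂ + o(k₂)`. -/
theorem hasDerivAt_exp_neg_A12 (hD : 0 < c * (c + 2 * k)) :
    HasDerivAt (fun k₂ => Real.exp (-A12 k k₂ c / 2)) (-beta k c) 0 := by
  have hD0 := hD.ne'
  have hn0 : (-k - c) ^ 2 - (k + 0) ^ 2 = c * (c + 2 * k) := by ring
  have hd0 : (-k - c) ^ 2 - (k - 0) ^ 2 = c * (c + 2 * k) := by ring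
  have hnum : HasDerivAt (fun k₂ : ℝ => (-k - c) ^ 2 - (k + k₂) ^ 2) (-(2 * k)) 0 :=
    ((((hasDerivAt_id (0 : ℝ)).const_add k).fun_pow 2).const_sub _).congr_deriv (by simp)
  have hden : HasDerivAt (fun k₂ : ℝ => (-k - c) ^ 2 - (k - k₂) ^ 2) (2 * k) 0 :=
    ((((hasDerivAt_id (0 : ℝ)).const_sub k).fun_pow 2).const_sub _).congr_deriv (by simp)
  -- The quotient equals 1 at `k₂ = 0`, so the logarithm is differentiable there, with derivative
  -- `-4k / (c (c + 2k))`; half of it is `-β`.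
  have h := ((((hnum.fun_div hden (by rw [hd0]; exact hD0)).log
    (by rw [hn0, hd0, div_self hD0]; exact one_ne_zero)).fun_neg.fun_neg).div_const 2).exp
  refine h.congr_deriv ?_
  rw [hn0, hd0, div_self hD0, Real.log_one, neg_zero, neg_zero, zero_div, Real.exp_zero, beta]
  generalize c * (c + 2 * k) = D at *
  field_simp
  ring

theorem tendsto_div_of_hasDerivAt {N : ℝ → ℂ} {d : ℂ} (h : HasDerivAt N d 0) (h0 : N 0 = 0) :
    Tendsto (fun y : ℝ => N y / y) (𝓝[≠] 0) (𝓝 d) := by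
  refine (hasDerivAt_iff_tendsto_slope.1 h).congr fun y => ?_
  rw [slope_def_module, h0, sub_zero, sub_zero, Complex.real_smul, Complex.ofReal_inv, div_eq_inv_mul]

/-- The sign change is the purpose of the shift: it makes the terms of each two-periodic function
cancel at `k₂ = 0`, so division by `k₂` leaves a difference quotient. -/
theorem exp_shifted_phase {k₂ : ℝ} (hk₂ : k₂ ≠ 0) (x₂ : ℝ) (x : ℂ) (t : ℝ) :
    Complex.exp (Complex.I * k₂ * xi c (x₂ + Real.pi / k₂) x t) =
      -Complex.exp (Complex.I * k₂ * xi c x₂ x t) := by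
  have hk : (k₂ : ℂ) ≠ 0 := by exact_mod_cast hk₂
  have h : Complex.I * k₂ * xi c (x₂ + Real.pi / k₂) x t =
      Complex.I * k₂ * xi c x₂ x t - Real.pi * Complex.I := by
    unfold xi
    push_cast
    field_simp
    ring
  rw [h, Complex.exp_sub, Complex.exp_pi_mul_I, div_neg, div_one]

theorem exp_shifted_phase_sub {k₂ : ℝ} (hk₂ : k₂ ≠ 0) (x₂ A : ℝ) (x : ℂ) (t : ℝ) :
    Complex.exp (Complex.I * k₂ * xi c (x₂ + Real.pi / k₂) x t - A / 2) =
      -(Complex.exp (Complex.I * k₂ * xi c x₂ x t) * Real.exp (-A / 2)) := by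
  rw [sub_eq_add_neg, Complex.exp_add, exp_shifted_phase hk₂, Complex.ofReal_exp]
  push_cast
  rw [neg_div, neg_mul]

theorem wave_sub_half (s A x₁ : ℝ) (x : ℂ) (t : ℝ) :
    wave k (s - A / 2) x₁ x t = Real.exp (-A / 2) * wave k s x₁ x t := by
  rw [sub_eq_add_neg, ← neg_div, wave_add]

theorem hasDerivAt_exp_phase (ξ : ℂ) :
    HasDerivAt (fun y : ℝ => Complex.exp (Complex.I * y * ξ)) (Complex.I * ξ) 0 := by
  have := ((((hasDerivAt_id (0 : ℝ)).ofReal_comp).const_mul Complex.I).mul_const ξ).cexp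
  simpa using this

theorem hasDerivAt_alpha2 (hc : c ≠ 0) : HasDerivAt (fun y => alpha2 y c) (-2 / c) 0 := by
  have h := ((hasDerivAt_id (0 : ℝ)).const_sub c).fun_div ((hasDerivAt_id (0 : ℝ)).const_add c)
    (by simpa using hc)
  refine h.congr_deriv ?_
  simp only [id, add_zero, sub_zero]
  field_simp
  ring

theorem alpha2_zero (hc : c ≠ 0) : alpha2 0 c = 1 := by
  simp [alpha2, hc]

theorem tendsto_gamma12 (hc : c ≠ 0) (γ : ℝ) :
    Tendsto (fun y => (gamma12 γ y c : ℂ)) (𝓝[≠] 0) (𝓝 γ) := by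
  have h : ContinuousAt (fun y => gamma12 γ y c) 0 := by
    unfold gamma12
    refine continuousAt_const.mul (ContinuousAt.sqrt (ContinuousAt.div (by fun_prop) (by fun_prop) ?_))
    simpa using hc
  have h0 : gamma12 γ 0 c = γ := by simp [gamma12, hc]
  have h1 := h.tendsto.mono_left (nhdsWithin_le_nhds (s := {0}ᶜ))
  rw [h0] at h1
  exact (Complex.continuous_ofReal.tendsto _).comp h1

theorem speed_ne_zero (hD : 0 < c * (c + 2 * k)) : c ≠ 0 := left_ne_zero_of_mul hD.ne'

theorem two_div_speed (hD : 0 < c * (c + 2 * k)) : (2 / c : ℂ) = beta k c + chi k c := by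
  have h : 2 / c = beta k c + chi k c := by
    rw [div_eq_iff (speed_ne_zero hD), mul_comm]
    exact (speed_mul_beta_add_chi hD).symm
  exact_mod_cast congrArg Complex.ofReal h

variable (φ γ x₁ x₂ : ℝ) (x : ℂ) (t : ℝ)

theorem tendsto_twoPeriodicF (hD : 0 < c * (c + 2 * k)) :
    Tendsto (fun k₂ : ℝ => twoPeriodicF k φ k₂ c x₁ (x₂ + Real.pi / k₂) x t / k₂)
      (𝓝[≠] 0) (𝓝 (breatherF k φ c x₁ x₂ x t)) := by
  have ha := (hasDerivAt_exp_neg_A12 hD).ofReal_comp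
  have hE := hasDerivAt_exp_phase (xi c x₂ x t)
  have hN := (((ha.mul_const (wave k (-φ) x₁ x t)).const_add 1).fun_sub (hE.fun_mul ha)).fun_sub
    (hE.const_mul (wave k (-φ) x₁ x t))
  have hlim := tendsto_div_of_hasDerivAt hN (by simp [A12_zero hD])
  refine Tendsto.congr' ?_ (hlim.trans_eq (congrArg 𝓝 ?_))
  · filter_upwards [self_mem_nhdsWithin] with y hy
    rw [twoPeriodicF, exp_shifted_phase hy, exp_shifted_phase_sub hy, wave_sub_half]
    ring
  · simp only [A12_zero hD, breatherF]
    simp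
    ring

/-- Replacing `φ` by `-φ` turns `f` into `f̃` on both sides, and the limit for `f` needs no sign of
`φ`. -/
theorem tendsto_twoPeriodicFt (hD : 0 < c * (c + 2 * k)) :
    Tendsto (fun k₂ : ℝ => twoPeriodicFt k φ k₂ c x₁ (x₂ + Real.pi / k₂) x t / k₂)
      (𝓝[≠] 0) (𝓝 (breatherFt k φ c x₁ x₂ x t)) := by
  simpa only [twoPeriodicF, twoPeriodicFt, breatherF, breatherFt, neg_neg] using
    tendsto_twoPeriodicF (-φ) x₁ x₂ x t hD

theorem tendsto_twoPeriodicG (hD : 0 < c * (c + 2 * k)) :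
    Tendsto (fun k₂ : ℝ => twoPeriodicG k φ γ k₂ c x₁ (x₂ + Real.pi / k₂) x t / k₂)
      (𝓝[≠] 0) (𝓝 (breatherG k φ γ c x₁ x₂ x t)) := by
  have hc := speed_ne_zero hD
  have ha := (hasDerivAt_exp_neg_A12 hD).ofReal_comp
  have hE := hasDerivAt_exp_phase (xi c x₂ x t)
  have hα := (hasDerivAt_alpha2 hc).ofReal_comp
  have hN := (ha.mul_const (wave k (-φ) x₁ x t)).fun_sub
    (hα.fun_mul (hE.const_mul (wave k (-φ) x₁ x t)))
  have hlim := (tendsto_gamma12 hc γ).mul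
    (tendsto_div_of_hasDerivAt hN (by simp [A12_zero hD, alpha2_zero hc]))
  refine Tendsto.congr' ?_ (hlim.trans_eq (congrArg 𝓝 ?_))
  · filter_upwards [self_mem_nhdsWithin] with y hy
    rw [twoPeriodicG, exp_shifted_phase hy, wave_sub_half]
    ring
  -- The derivatives of `e^{-A₁₂/2}` and `α₂` combine to `2/c - β`, which is `χ`.
  · have h := two_div_speed hD
    simp only [alpha2_zero hc, breatherG]
    simp [neg_div, h]
    ring

theorem tendsto_twoPeriodicGt (hD : 0 < c * (c + 2 * k)) :
    Tendsto (fun k₂ : ℝ => twoPeriodicGt k γ k₂ c (x₂ + Real.pi / k₂) x t / k₂)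
      (𝓝[≠] 0) (𝓝 (breatherGt k γ c x₂ x t)) := by
  have hc := speed_ne_zero hD
  have ha := (hasDerivAt_exp_neg_A12 hD).ofReal_comp
  have hE := hasDerivAt_exp_phase (xi c x₂ x t)
  have hα := (hasDerivAt_alpha2 hc).ofReal_comp
  have hN := hα.fun_sub (hE.fun_mul ha)
  have hlim := (tendsto_gamma12 hc γ).mul
    (tendsto_div_of_hasDerivAt hN (by simp [A12_zero hD, alpha2_zero hc]))
  refine Tendsto.congr' ?_ (hlim.trans_eq (congrArg 𝓝 ?_))
  · filter_upwards [self_mem_nhdsWithin] with y hy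
    rw [twoPeriodicGt, exp_shifted_phase_sub hy]
    ring
  · have h := two_div_speed hD
    simp only [A12_zero hD, breatherGt]
    simp [neg_div, h]

theorem tendsto_twoPeriodic_quotient (hk : 0 < k) {φ : ℝ} (hφ : 0 < φ) (hD : 0 < c * (c + 2 * k))
    (x : ℝ) :
    Tendsto (fun k₂ : ℝ => twoPeriodicG k φ γ k₂ c x₁ (x₂ + Real.pi / k₂) x t /
        twoPeriodicF k φ k₂ c x₁ (x₂ + Real.pi / k₂) x t)
      (𝓝[≠] 0) (𝓝 (breatherG k φ γ c x₁ x₂ x t / breatherF k φ c x₁ x₂ x t)) := by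
  refine ((tendsto_twoPeriodicG φ γ x₁ x₂ x t hD).div (tendsto_twoPeriodicF φ x₁ x₂ x t hD)
    (breatherF_ne_zero x₁ x₂ hk hφ hD (by simp) t)).congr' ?_
  filter_upwards [self_mem_nhdsWithin] with y hy
  have hy' : (y : ℂ) ≠ 0 := by exact_mod_cast hy
  exact div_div_div_cancel_right₀ hy' _ _

end LongWave

end NonlocalDNLS

/-! ### Assembly of the statements. -/

theorem mainTheorem6 (k₁ φ₁ γ₁ c₂ x₁ x₂ : ℝ) (hk₁ : 0 < k₁) (hφ₁ : 0 < φ₁)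
    (hγ₁ : γ₁ ^ 2 = k₁ * (Real.exp (2 * φ₁) - 1))
    (hc₂ : c₂ ∈ Set.Ioi (0 : ℝ) ∨ c₂ ∈ Set.Iio (-2 * k₁)) :
    -- positivity of the constants
    0 < γ₁ ^ 2 ∧ 0 < NonlocalDNLS.beta k₁ c₂ ∧
    -- location of the zeros
    (∀ (x : ℂ) (t : ℝ), NonlocalDNLS.breatherF k₁ φ₁ c₂ x₁ x₂ x t = 0 → x.im < 0) ∧
    (∀ (x : ℂ) (t : ℝ), NonlocalDNLS.breatherFt k₁ φ₁ c₂ x₁ x₂ x t = 0 → 0 < x.im) ∧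
    -- the breather solution
    NonlocalDNLS.IsBreatherOn (-1) (NonlocalDNLS.periodicWave k₁ φ₁ γ₁ x₁) c₂
      (fun x t : ℝ => NonlocalDNLS.breatherG k₁ φ₁ γ₁ c₂ x₁ x₂ x t /
        NonlocalDNLS.breatherF k₁ φ₁ c₂ x₁ x₂ x t) ∧
    -- the representation of its complex conjugate and of its squared modulus
    (∀ x t : ℝ,
      conj (NonlocalDNLS.breatherG k₁ φ₁ γ₁ c₂ x₁ x₂ x t /
          NonlocalDNLS.breatherF k₁ φ₁ c₂ x₁ x₂ x t) =
        NonlocalDNLS.breatherGt k₁ γ₁ c₂ x₂ x t /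
          NonlocalDNLS.breatherFt k₁ φ₁ c₂ x₁ x₂ x t ∧
      ((‖NonlocalDNLS.breatherG k₁ φ₁ γ₁ c₂ x₁ x₂ x t /
          NonlocalDNLS.breatherF k₁ φ₁ c₂ x₁ x₂ x t‖ ^ 2 : ℝ) : ℂ) =
        Complex.I * logDeriv (fun y : ℝ => NonlocalDNLS.breatherF k₁ φ₁ c₂ x₁ x₂ y t /
          NonlocalDNLS.breatherFt k₁ φ₁ c₂ x₁ x₂ y t) x) ∧
    -- the long-wave limit of the two-periodic wave
    (∀ (x : ℂ) (t : ℝ),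
      Tendsto (fun k₂ : ℝ =>
          NonlocalDNLS.twoPeriodicF k₁ φ₁ k₂ c₂ x₁ (x₂ + Real.pi / k₂) x t / k₂)
        (𝓝[≠] 0) (𝓝 (NonlocalDNLS.breatherF k₁ φ₁ c₂ x₁ x₂ x t)) ∧
      Tendsto (fun k₂ : ℝ =>
          NonlocalDNLS.twoPeriodicFt k₁ φ₁ k₂ c₂ x₁ (x₂ + Real.pi / k₂) x t / k₂)
        (𝓝[≠] 0) (𝓝 (NonlocalDNLS.breatherFt k₁ φ₁ c₂ x₁ x₂ x t)) ∧
      Tendsto (fun k₂ : ℝ =>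
          NonlocalDNLS.twoPeriodicG k₁ φ₁ γ₁ k₂ c₂ x₁ (x₂ + Real.pi / k₂) x t / k₂)
        (𝓝[≠] 0) (𝓝 (NonlocalDNLS.breatherG k₁ φ₁ γ₁ c₂ x₁ x₂ x t)) ∧
      Tendsto (fun k₂ : ℝ =>
          NonlocalDNLS.twoPeriodicGt k₁ γ₁ k₂ c₂ (x₂ + Real.pi / k₂) x t / k₂)
        (𝓝[≠] 0) (𝓝 (NonlocalDNLS.breatherGt k₁ γ₁ c₂ x₂ x t))) ∧
    (∀ x t : ℝ,
      Tendsto (fun k₂ : ℝ =>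
          NonlocalDNLS.twoPeriodicG k₁ φ₁ γ₁ k₂ c₂ x₁ (x₂ + Real.pi / k₂) x t /
            NonlocalDNLS.twoPeriodicF k₁ φ₁ k₂ c₂ x₁ (x₂ + Real.pi / k₂) x t)
        (𝓝[≠] 0) (𝓝 (NonlocalDNLS.breatherG k₁ φ₁ γ₁ c₂ x₁ x₂ x t /
          NonlocalDNLS.breatherF k₁ φ₁ c₂ x₁ x₂ x t))) := by

  have hD := NonlocalDNLS.speed_mul_pos hk₁ hc₂
  have hγ : 0 < γ₁ ^ 2 := by
    rw [hγ₁]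
    exact mul_pos hk₁ (sub_pos.2 (Real.one_lt_exp_iff.2 (by linarith)))
  refine ⟨hγ, NonlocalDNLS.beta_pos hk₁ hD, fun x t h => ?_, fun x t h => ?_,
    NonlocalDNLS.isBreatherOn_breather x₁ x₂ hk₁ hφ₁ hD (NonlocalDNLS.speed_add_ne_zero hk₁ hc₂) hγ₁
      (by rintro rfl; simp at hγ),
    fun x t => ⟨NonlocalDNLS.conj_breather k₁ φ₁ γ₁ c₂ x₁ x₂ t x,
      NonlocalDNLS.norm_sq_breather x₁ x₂ hk₁ hφ₁ hD hγ₁ x t⟩,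
    fun x t => ⟨NonlocalDNLS.tendsto_twoPeriodicF φ₁ x₁ x₂ x t hD,
      NonlocalDNLS.tendsto_twoPeriodicFt φ₁ x₁ x₂ x t hD,
      NonlocalDNLS.tendsto_twoPeriodicG φ₁ γ₁ x₁ x₂ x t hD,
      NonlocalDNLS.tendsto_twoPeriodicGt γ₁ x₂ x t hD⟩,
    fun x t => NonlocalDNLS.tendsto_twoPeriodic_quotient γ₁ x₁ x₂ t hk₁ hφ₁ hD x⟩
  · by_contra! hx
    exact NonlocalDNLS.breatherF_ne_zero x₁ x₂ hk₁ hφ₁ hD hx t h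
  · by_contra! hx
    exact NonlocalDNLS.breatherFt_ne_zero x₁ x₂ hk₁ hφ₁ hD hx t h
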